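/- Let $k\ge 3$ and $E_k=\{0,\dots,k-1\}$. A clone on $E_k$ is a set of operations $E_k^n\to E_k$ ($n\ge 1$) that contains all projections and is closed under composition; for a set $R$ of finitary relations on $E_k$, $\mathrm{Pol}\,R$ is the clone of all operations that preserve every relation in $R$, and $\mathrm{Pol}\,\rho=\mathrm{Pol}\{\rho\}$. A clone $\mathcal C$ is maximal below a clone $\mathcal D$ if $\mathcal C\subsetneq\mathcal D$ and there is no clone strictly between them. An $h$-ary relation $\rho\subseteq E_k^h$ ($h\ge 1$) is central if it contains every tuple with two equal entries at different positions, is invariant under all permutations of its coordinates, and its center $C_\rho=\{a\in E_k : (a,a_2,\dots,a_h)\in\rho \text{ for all } a_2,\dots,a_h\in E_k\}$ is nonempty and different from $E_k$. (Thus a unary central relation is a nonempty proper subset of $E_k$.) A $\rho$-chain is a set $B\subseteq E_k$ with $B^h\subseteq\rho$; it is maximal if it is not properly contained in another $\rho$-chain. **Theorem.** Let $k\ge 3$, let $\rho$ be an $h$-ary central relation on $E_k$ with $h\ge 2$, and let $\sigma\ne\rho$ be an $s$-ary central relation on $E_k$ with $s\ge 1$. Then $\mathrm{Pol}\{\rho,\sigma\}$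 is maximal below $\mathrm{Pol}\,\rho$ if and only if at least one of the following five conditions holds: (I) $s=1$ and $C_\rho\cap\sigma\ne\emptyset$; (II) $s=1$, $h=2$, $\rho=\{(a,b)\in E_k^2 : \exists u\in\sigma,\ (a,u)\in\rho \text{ and } (b,u)\in\rho\}$, and $B\cap\sigma\neq\emptyset$ for every maximal $\rho$-chain $B$; (III) $s=h$, and either $\rho\subsetneq\sigma$ or $\sigma\subsetneq\rho$; (IV) $2\le s<h$ and $C_\rho\cap C_\sigma\ne\emptyset$; (V) $2\le h<s$ and $\{(a_1,\dots,a_s)\in E_k^s : (a_1,\dots,a_h)\in\rho\}\subsetneq\sigma$. -/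

import Mathlib

/-
Given a relation `R`, the operation that sends the rows of the matrix whose columns are the tuples
of `R` to the entries of `w`, and every other argument to a central element of `ρ`, preserves `ρ` as
soon as `w` satisfies every constraint `(w (q 0), …, w (q (h - 1))) ∈ ρ` that holds throughout `R`.
So these constraints determine the `Pol ρ`-invariant relations `R` with distinct rows.

Sufficiency: if the centers meet, an operation `g` of `Pol ρ` is obtained from an operation
preserving both relations by feeding it, as control arguments, operations of the larger clone that
leave `σ` wherever `g` does; the control arguments allow the value to be reset to a common central
element outside the range of interest. In case (II) one control argument, a constant outside `σ`,
is enough: when it lies in `σ`, the values are replaced by elements of `σ` chosen from maximal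
chains.

Necessity: every relation `R` invariant under `Pol {ρ, σ}` that is preserved by one operation of
`Pol ρ` outside `Pol σ` is, by maximality, invariant under `Pol ρ`, hence contains every tuple that
satisfies its constraints. Suitable `R` express that the elements of a family can be completed
to tuples of `ρ` by an element of `σ` (when `σ` is unary), or that one element can be added to two
families at once, to the first inside `ρ` and to the second inside `σ`; applied to families that
list all of `A`, they produce elements of `center ρ` in `σ` or in `center σ`. With a
common central element at hand, `R = σ ∩ extendArity ρ` yields the inclusions.
-/

namespace CloneTheory

/-- A clone on `A`: a set of finitary operations of arities `n ≥ 1` (sorted by arity) that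
contains the projections and is closed under composition. -/
@[ext]
structure OpClone (A : Type*) where
  /-- the `n`-ary operations of the clone -/
  ops : ∀ n : ℕ, Set ((Fin n → A) → A)
  ops_zero : ops 0 = ∅
  proj_mem : ∀ (n : ℕ) (i : Fin n), (fun x : Fin n → A => x i) ∈ ops n
  comp_mem : ∀ (m n : ℕ) (g : (Fin m → A) → A) (f : Fin m → (Fin n → A) → A),
    g ∈ ops m → (∀ i, f i ∈ ops n) → (fun x : Fin n → A => g (fun i => f i x)) ∈ ops n

/-- Clones are ordered by inclusion. -/
instance OpClone.instPartialOrder (A : Type*) : PartialOrder (OpClone A) :=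
  PartialOrder.lift OpClone.ops (fun _ _ h => OpClone.ext h)

/-- The operation `f` preserves the relation `ρ`: applying `f` coordinatewise to tuples
`a 0, …, a (n - 1)` of `ρ` gives a tuple of `ρ`. -/
def Preserves {A : Type*} {n h : ℕ} (f : (Fin n → A) → A) (ρ : Set (Fin h → A)) : Prop :=
  ∀ a : Fin n → Fin h → A, (∀ j, a j ∈ ρ) → (fun i : Fin h => f (fun j => a j i)) ∈ ρ

/-- Finitary relations on `A`, bundled with their arity. -/
abbrev FinRel (A : Type*) : Type _ := Σ h : ℕ, Set (Fin h → A)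

/-- `Pol R`: the clone of all operations (of arity at least one) preserving every relation
in `R`. -/
def Pol {A : Type*} (R : Set (FinRel A)) : OpClone A where
  ops n := {f | 0 < n ∧ ∀ r ∈ R, Preserves f r.2}
  ops_zero := by
    ext f
    simp
  proj_mem n i := ⟨Nat.lt_of_le_of_lt (Nat.zero_le _) i.isLt, fun _ _ _ ha => ha i⟩
  comp_mem m n g f hg hf :=
    ⟨(hf ⟨0, hg.1⟩).1, fun r hr a ha => hg.2 r hr _ (fun i => (hf i).2 r hr a ha)⟩

/-- `ρ` contains every tuple with two equal entries at different positions. -/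
def TotallyReflexive {A : Type*} {h : ℕ} (ρ : Set (Fin h → A)) : Prop :=
  ∀ x : Fin h → A, (∃ i j : Fin h, i ≠ j ∧ x i = x j) → x ∈ ρ

/-- `ρ` is invariant under every permutation of its coordinates. -/
def TotallySymmetric {A : Type*} {h : ℕ} (ρ : Set (Fin h → A)) : Prop :=
  ∀ π : Equiv.Perm (Fin h), ∀ x ∈ ρ, (fun i => x (π i)) ∈ ρ

/-- The center of `ρ`: all `a` such that every tuple whose first entry is `a` lies in `ρ`. -/
def center {A : Type*} {h : ℕ} (ρ : Set (Fin h → A)) : Set A :=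
  {a | ∀ x : Fin h → A, (∃ i : Fin h, (i : ℕ) = 0 ∧ x i = a) → x ∈ ρ}

/-- Central relations. -/
structure IsCentral {A : Type*} {h : ℕ} (ρ : Set (Fin h → A)) : Prop where
  arity_pos : 1 ≤ h
  totallyReflexive : TotallyReflexive ρ
  totallySymmetric : TotallySymmetric ρ
  center_nonempty : (center ρ).Nonempty
  center_ne_univ : center ρ ≠ Set.univ

/-- Transport of a relation along an equality of arities. -/
def castArity {A : Type*} {h h' : ℕ} (e : h = h') (ρ : Set (Fin h → A)) :
    Set (Fin h' → A) :=
  {x | (fun i : Fin h => x (Fin.cast e i)) ∈ ρ}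

/-- A unary relation viewed as a subset of `A`. -/
def unarySet {A : Type*} (σ : Set (Fin 1 → A)) : Set A :=
  {u | ![u] ∈ σ}

/-- The pairs `(a, b)` with a common `ρ`-neighbour in the unary relation `σ`. -/
def commonNeighbour {A : Type*} (ρ : Set (Fin 2 → A)) (σ : Set (Fin 1 → A)) :
    Set (Fin 2 → A) :=
  {x | ∃ u ∈ unarySet σ, ![x 0, u] ∈ ρ ∧ ![x 1, u] ∈ ρ}

/-- `B` is a `ρ`-chain: all tuples with entries in `B` lie in `ρ`. -/
def IsRelChain {A : Type*} {h : ℕ} (ρ : Set (Fin h → A)) (B : Set A) : Prop :=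
  ∀ x : Fin h → A, (∀ i, x i ∈ B) → x ∈ ρ

/-- The extension of the `h`-ary relation `ρ` to arity `s ≥ h`: the first `h` entries form
a tuple of `ρ`. -/
def extendArity {A : Type*} {h s : ℕ} (e : h ≤ s) (ρ : Set (Fin h → A)) :
    Set (Fin s → A) :=
  {x | (fun i : Fin h => x (Fin.castLE e i)) ∈ ρ}

/-- Condition (I): `σ` is unary and meets the center of `ρ`. -/
def TypeI {A : Type*} {h s : ℕ} (ρ : Set (Fin h → A)) (σ : Set (Fin s → A)) : Prop :=
  ∃ es : s = 1, (center ρ ∩ unarySet (castArity es σ)).Nonempty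

/-- Condition (II): `σ` is unary, `ρ` is the binary relation of pairs with a common
`ρ`-neighbour in `σ`, and every (inclusion-)maximal `ρ`-chain meets `σ`. -/
def TypeII {A : Type*} {h s : ℕ} (ρ : Set (Fin h → A)) (σ : Set (Fin s → A)) : Prop :=
  ∃ (es : s = 1) (eh : h = 2),
    castArity eh ρ = commonNeighbour (castArity eh ρ) (castArity es σ) ∧
      ∀ B : Set A, Maximal (IsRelChain ρ) B → (B ∩ unarySet (castArity es σ)).Nonempty

/-- Condition (III): `ρ` and `σ` have the same arity and one is strictly contained in the
other. -/
def TypeIII {A : Type*} {h s : ℕ} (ρ : Set (Fin h → A)) (σ : Set (Fin s → A)) : Prop :=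
  ∃ e : s = h, ρ ⊂ castArity e σ ∨ castArity e σ ⊂ ρ

/-- Condition (IV): `2 ≤ s < h` and the centers meet. -/
def TypeIV {A : Type*} {h s : ℕ} (ρ : Set (Fin h → A)) (σ : Set (Fin s → A)) : Prop :=
  2 ≤ s ∧ s < h ∧ (center ρ ∩ center σ).Nonempty

/-- Condition (V): `2 ≤ h < s` and the extension of `ρ` to arity `s` is strictly contained
in `σ`. -/
def TypeV {A : Type*} {h s : ℕ} (ρ : Set (Fin h → A)) (σ : Set (Fin s → A)) : Prop :=
  2 ≤ h ∧ ∃ e : h < s, extendArity e.le ρ ⊂ σ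

end CloneTheory

namespace CloneTheory

open Function

section Clones

variable {A N ι : Type*} {h s : ℕ}

/-- Preservation of relations by operations, with arbitrary index types for the arguments of the
operation and for the coordinates of the relation; on `Fin` it is `Preserves`. -/
def PreservesRel (f : (N → A) → A) (R : Set (ι → A)) : Prop :=
  ∀ a : N → ι → A, (∀ j, a j ∈ R) → (fun i => f fun j => a j i) ∈ R

theorem PreservesRel.reindex {M : Type*} {f : (N → A) → A} {R : Set (ι → A)}
    (hf : PreservesRel f R) (e : N → M) : PreservesRel (fun x : M → A => f fun j => x (e j)) R :=
  fun a ha => hf (fun j => a (e j)) fun j => ha (e j)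

/-- The operations of a clone with arguments indexed by a finite type `N` instead of `Fin n`. -/
def OpClone.opsOn (C : OpClone A) (N : Type*) : Set ((N → A) → A) :=
  {f | ∃ (n : ℕ) (e : N ≃ Fin n), (fun x : Fin n → A => f fun j => x (e j)) ∈ C.ops n}

theorem OpClone.opsOn_mono {C D : OpClone A} (hCD : C ≤ D) : C.opsOn N ⊆ D.opsOn N :=
  fun _ ⟨n, e, he⟩ => ⟨n, e, hCD n he⟩

theorem OpClone.comp_mem_of_mem_opsOn {C : OpClone A} {n : ℕ} {g : (N → A) → A}
    (hg : g ∈ C.opsOn N) {F : N → (Fin n → A) → A} (hF : ∀ j, F j ∈ C.ops n) :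
    (fun x => g fun j => F j x) ∈ C.ops n := by
  obtain ⟨m, e, he⟩ := hg
  simpa using C.comp_mem m n _ (fun i => F (e.symm i)) he fun i => hF _

theorem mem_ops_pol_singleton {ρ : Set (Fin h → A)} {n : ℕ} {f : (Fin n → A) → A} :
    f ∈ (Pol {⟨h, ρ⟩}).ops n ↔ 0 < n ∧ PreservesRel f ρ := by
  simp [Pol, Preserves, PreservesRel]

theorem mem_ops_pol_pair {ρ : Set (Fin h → A)} {σ : Set (Fin s → A)} {n : ℕ}
    {f : (Fin n → A) → A} :
    f ∈ (Pol {⟨h, ρ⟩, ⟨s, σ⟩}).ops n ↔ 0 < n ∧ PreservesRel f ρ ∧ PreservesRel f σ := by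
  simp [Pol, Preserves, PreservesRel]

theorem mem_opsOn_pol [Finite N] [Nonempty N] {S : Set (FinRel A)} {f : (N → A) → A} :
    f ∈ (Pol S).opsOn N ↔ ∀ r ∈ S, PreservesRel f r.2 := by
  constructor
  · rintro ⟨n, e, he⟩ r hr
    have hfe : PreservesRel (fun x : Fin n → A => f fun j => x (e j)) r.2 := he.2 r hr
    simpa using hfe.reindex e.symm
  · intro hf
    obtain ⟨n, ⟨e⟩⟩ := Finite.exists_equiv_fin N
    exact ⟨n, e, (e (Classical.arbitrary N)).pos, fun r hr => (hf r hr).reindex e⟩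

theorem mem_opsOn_pol_pair [Finite N] [Nonempty N] {ρ : Set (Fin h → A)} {σ : Set (Fin s → A)}
    {f : (N → A) → A} :
    f ∈ (Pol {⟨h, ρ⟩, ⟨s, σ⟩}).opsOn N ↔ PreservesRel f ρ ∧ PreservesRel f σ := by
  simp [mem_opsOn_pol]

/-- `R` is an invariant relation of the clone `C`: all operations of `C` preserve it. -/
def OpClone.Invariant (C : OpClone A) (R : Set (ι → A)) : Prop :=
  ∀ n, ∀ f ∈ C.ops n, PreservesRel f R

theorem OpClone.Invariant.preservesRel {C : OpClone A} {R : Set (ι → A)} (hR : C.Invariant R)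
    {f : (N → A) → A} (hf : f ∈ C.opsOn N) : PreservesRel f R := by
  obtain ⟨n, e, he⟩ := hf
  simpa using (hR n _ he).reindex e.symm

/-- The subclone of the operations of `C` that preserve `R`. -/
def OpClone.preserving (C : OpClone A) (R : Set (ι → A)) : OpClone A where
  ops n := {f | f ∈ C.ops n ∧ PreservesRel f R}
  ops_zero := by simp [C.ops_zero]
  proj_mem n i := ⟨C.proj_mem n i, fun _ ha => ha i⟩
  comp_mem m n g f hg hf := ⟨C.comp_mem m n g f hg.1 fun i => (hf i).1,
    fun a ha => hg.2 _ fun i => (hf i).2 a ha⟩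

theorem OpClone.mem_opsOn_preserving {C : OpClone A} {R : Set (ι → A)} {f : (N → A) → A}
    (hf : f ∈ C.opsOn N) (hfR : PreservesRel f R) : f ∈ (C.preserving R).opsOn N := by
  obtain ⟨n, e, he⟩ := hf
  exact ⟨n, e, he, hfR.reindex e⟩

theorem OpClone.invariant_or_preserving_eq_of_covBy {C D : OpClone A} (hCD : C ⋖ D)
    {R : Set (ι → A)} (hR : C.Invariant R) : D.Invariant R ∨ D.preserving R = C := by
  have hC : C ≤ D.preserving R := fun n f hf => ⟨hCD.le n hf, hR n f hf⟩
  have hD : D.preserving R ≤ D := fun n f hf => hf.1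
  refine (hCD.eq_or_eq hC hD).symm.imp_left fun heq n f hf => ?_
  rw [← heq] at hf
  exact hf.2

theorem pol_pair_le {ρ : Set (Fin h → A)} {σ : Set (Fin s → A)} :
    Pol {⟨h, ρ⟩, ⟨s, σ⟩} ≤ Pol {⟨h, ρ⟩} :=
  fun _ _ hf => ⟨hf.1, fun r hr => hf.2 r (Set.mem_insert_iff.2 (Or.inl hr))⟩

/-- `Pol {ρ, σ}` is maximal below `Pol ρ`. -/
def IsSubmaximal (ρ : Set (Fin h → A)) (σ : Set (Fin s → A)) : Prop :=
  Pol {⟨h, ρ⟩, ⟨s, σ⟩} ⋖ Pol {⟨h, ρ⟩}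

theorem IsSubmaximal.invariant {ρ : Set (Fin h → A)} {σ : Set (Fin s → A)}
    (hcov : IsSubmaximal ρ σ) {R : Set (ι → A)} (hR : (Pol {⟨h, ρ⟩, ⟨s, σ⟩}).Invariant R)
    [Finite N] [Nonempty N] {f : (N → A) → A} (hfρ : PreservesRel f ρ) (hfσ : ¬ PreservesRel f σ)
    (hfR : PreservesRel f R) : (Pol {⟨h, ρ⟩}).Invariant R := by
  refine (OpClone.invariant_or_preserving_eq_of_covBy hcov hR).resolve_right fun heq => hfσ ?_
  have hf : f ∈ (Pol {⟨h, ρ⟩}).opsOn N := mem_opsOn_pol.2 (by simpa using hfρ)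
  exact (mem_opsOn_pol_pair.1 (heq ▸ OpClone.mem_opsOn_preserving hf hfR)).2

theorem isSubmaximal_of_forall_le {ρ : Set (Fin h → A)} {σ : Set (Fin s → A)}
    [Finite N] [Nonempty N] {f : (N → A) → A} (hfρ : PreservesRel f ρ) (hfσ : ¬ PreservesRel f σ)
    (hgen : ∀ G : OpClone A, Pol {⟨h, ρ⟩, ⟨s, σ⟩} ≤ G →
      ∀ n, ∀ g ∈ G.ops n, ¬ PreservesRel g σ → Pol {⟨h, ρ⟩} ≤ G) : IsSubmaximal ρ σ := by
  refine ⟨lt_of_le_of_ne pol_pair_le fun heq => hfσ ?_, fun G hCG hGD => hGD.not_ge ?_⟩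
  · have hf : f ∈ (Pol {⟨h, ρ⟩}).opsOn N := mem_opsOn_pol.2 (by simpa using hfρ)
    exact (mem_opsOn_pol_pair.1 (heq ▸ hf)).2
  · obtain ⟨n, hn⟩ := not_forall.1 hCG.not_ge
    obtain ⟨g, hg, hgC⟩ := Set.not_subset.1 hn
    have hgρ := mem_ops_pol_singleton.1 (hGD.le n hg)
    exact hgen G hCG.le n g hg fun hgσ => hgC (mem_ops_pol_pair.2 ⟨hgρ.1, hgρ.2, hgσ⟩)

end Clones

section Central

variable {A ι : Type*} {h s : ℕ} {ρ : Set (Fin h → A)} {σ : Set (Fin s → A)} {B B' : Set A}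
  {c u : A}

theorem TotallyReflexive.comp_mem_of_not_injective (hρ : TotallyReflexive ρ) (y : ι → A)
    {q : Fin h → ι} (hq : ¬ Injective q) : (fun i => y (q i)) ∈ ρ := by
  simp only [Injective, not_forall] at hq
  obtain ⟨i, j, hij, hne⟩ := hq
  exact hρ _ ⟨i, j, hne, congrArg y hij⟩

theorem TotallyReflexive.injective_of_notMem (hρ : TotallyReflexive ρ) {x : Fin h → A}
    (hx : x ∉ ρ) : Injective x := by
  by_contra hinj
  exact hx (hρ.comp_mem_of_not_injective id hinj)

theorem TotallyReflexive.isRelChain_of_encard_lt (hρ : TotallyReflexive ρ) (hB : B.encard < h) :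
    IsRelChain ρ B := by
  intro x hx
  by_contra hxρ
  have hrange : (h : ℕ∞) ≤ (Set.range x).encard := by
    simpa using (hρ.injective_of_notMem hxρ).encard_range
  exact hB.not_ge (hrange.trans (Set.encard_le_encard (Set.range_subset_iff.2 hx)))

theorem TotallyReflexive.isRelChain_singleton (hρ : TotallyReflexive ρ) (hh : 2 ≤ h) (a : A) :
    IsRelChain ρ {a} :=
  hρ.isRelChain_of_encard_lt (by simpa [Nat.lt_iff_add_one_le] using hh)

namespace IsCentral

theorem comp_mem (hρ : IsCentral ρ) {x : Fin h → A} (hx : x ∈ ρ) (q : Fin h → Fin h) :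
    (fun i => x (q i)) ∈ ρ := by
  by_cases hq : Injective q
  · exact hρ.totallySymmetric (Equiv.ofBijective q (Finite.injective_iff_bijective.1 hq)) x hx
  · exact hρ.totallyReflexive.comp_mem_of_not_injective x hq

theorem mem_of_mem_center (hρ : IsCentral ρ) {x : Fin h → A} (i : Fin h) (hi : x i ∈ center ρ) :
    x ∈ ρ := by
  let i₀ : Fin h := ⟨0, hρ.arity_pos⟩
  have hswap := hi (fun j => x (Equiv.swap i₀ i j)) ⟨i₀, rfl, by simp⟩
  simpa using hρ.comp_mem hswap (Equiv.swap i₀ i)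

theorem exists_notMem_apply_eq (hρ : IsCentral ρ) (hc : c ∉ center ρ) (i : Fin h) :
    ∃ x, x ∉ ρ ∧ x i = c := by
  simp only [center, Set.mem_ofPred_eq, not_forall] at hc
  obtain ⟨x, ⟨j, -, hj⟩, hx⟩ := hc
  refine ⟨fun l => x (Equiv.swap i j l), fun hmem => hx ?_, by simpa using hj⟩
  simpa using hρ.comp_mem hmem (Equiv.swap i j)

theorem exists_notMem (hρ : IsCentral ρ) : ∃ x, x ∉ ρ := by
  obtain ⟨c, hc⟩ := (Set.ne_univ_iff_exists_notMem _).1 hρ.center_ne_univ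
  obtain ⟨x, hx, -⟩ := hρ.exists_notMem_apply_eq hc ⟨0, hρ.arity_pos⟩
  exact ⟨x, hx⟩

theorem nonempty (hρ : IsCentral ρ) : ρ.Nonempty := by
  obtain ⟨c, hc⟩ := hρ.center_nonempty
  exact ⟨fun _ => c, hρ.mem_of_mem_center ⟨0, hρ.arity_pos⟩ hc⟩

theorem exists_ne (hρ : IsCentral ρ) (c : A) : ∃ a, a ≠ c := by
  by_contra! hall
  have : Subsingleton A := ⟨fun a b => (hall a).trans (hall b).symm⟩
  exact hρ.center_ne_univ hρ.center_nonempty.eq_univ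

theorem isRelChain_union_center (hρ : IsCentral ρ) (hB : IsRelChain ρ B) :
    IsRelChain ρ (B ∪ center ρ) := by
  intro x hx
  by_cases hcen : ∃ i, x i ∈ center ρ
  · obtain ⟨i, hi⟩ := hcen
    exact hρ.mem_of_mem_center i hi
  · exact hB x fun i => (hx i).resolve_right fun hi => hcen ⟨i, hi⟩

end IsCentral

/-- The center of `ρ` relative to `B`: the elements that may stand at any position of a tuple whose
other entries come from `B`. -/
def centerOver (ρ : Set (Fin h → A)) (B : Set A) : Set A :=
  {u | ∀ (x : Fin h → A) (i : Fin h), x i = u → (∀ j ≠ i, x j ∈ B) → x ∈ ρ}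

theorem centerOver_anti (hBB' : B ⊆ B') : centerOver ρ B' ⊆ centerOver ρ B :=
  fun _ hu x i hi hx => hu x i hi fun j hj => hBB' (hx j hj)

theorem centerOver_univ_subset_center : centerOver ρ Set.univ ⊆ center ρ :=
  fun _ hu x ⟨i, _, hi⟩ => hu x i hi fun _ _ => Set.mem_univ _

theorem IsCentral.center_subset_centerOver (hρ : IsCentral ρ) : center ρ ⊆ centerOver ρ B :=
  fun _ hu _ i hi _ => hρ.mem_of_mem_center i (hi ▸ hu)

theorem IsCentral.centerOver_subset_centerOver_union_center (hρ : IsCentral ρ) :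
    centerOver ρ B ⊆ centerOver ρ (B ∪ center ρ) := by
  intro u hu x i hi hx
  by_cases hcen : ∃ j, x j ∈ center ρ
  · obtain ⟨j, hj⟩ := hcen
    exact hρ.mem_of_mem_center j hj
  · exact hu x i hi fun j hj => (hx j hj).resolve_right fun hj' => hcen ⟨j, hj'⟩

theorem IsRelChain.mem_centerOver (hB : IsRelChain ρ B) (hu : u ∈ B) (hB' : B' ⊆ B) :
    u ∈ centerOver ρ B' := by
  refine fun x i hi hx => hB x fun j => ?_
  by_cases hj : j = i
  · rwa [hj, hi]
  · exact hB' (hx j hj)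

theorem PreservesRel.mem_centerOver {N : Type*} {f : (N → A) → A} (hf : PreservesRel f ρ)
    {u : N → A} {y : N → ι → A} (hu : ∀ j, u j ∈ centerOver ρ (Set.range (y j))) :
    f u ∈ centerOver ρ (Set.range fun k => f fun j => y j k) := by
  classical
  intro x i hi hx
  choose p hp using hx
  let a : N → Fin h → A := fun j l => if hl : l = i then u j else y j (p l hl)
  have hax : (fun l => f fun j => a j l) = x := by
    funext l
    by_cases hl : l = i
    · subst hl
      simp only [a, dite_true, hi]
    · simp only [a, hl, dite_false, hp]
  rw [← hax]
  refine hf a fun j => hu j (a j) i (by simp [a]) fun l hl => ⟨p l hl, by simp [a, hl]⟩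

end Central

section RowOp

variable {A N ι : Type*} {h s : ℕ} {ρ : Set (Fin h → A)} {σ : Set (Fin s → A)} {c : A}

theorem IsCentral.preservesRel_of_forall (hρ : IsCentral ρ) (hc : c ∈ center ρ) {f : (N → A) → A}
    {P : (N → A) → Prop} (hfc : ∀ z, ¬ P z → f z = c)
    (hfP : ∀ a : N → Fin h → A, (∀ j, a j ∈ ρ) → (∀ i, P fun j => a j i) →
      (fun i => f fun j => a j i) ∈ ρ) : PreservesRel f ρ := by
  intro a ha
  by_cases hP : ∀ i, P fun j => a j i
  · exact hfP a ha hP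
  · obtain ⟨i, hi⟩ := not_forall.1 hP
    exact hρ.mem_of_mem_center i (by rwa [hfc _ hi])

/-- The tuples that satisfy all the constraints `(y (q 0), …, y (q (h - 1))) ∈ ρ` satisfied
throughout `R`. -/
def relClosure (ρ : Set (Fin h → A)) (R : Set (ι → A)) : Set (ι → A) :=
  {y | ∀ q : Fin h → ι, (∀ t ∈ R, (fun m => t (q m)) ∈ ρ) → (fun m => y (q m)) ∈ ρ}

theorem TotallyReflexive.mem_relClosure (hρ : TotallyReflexive ρ) {R : Set (ι → A)} {y : ι → A}
    (hy : ∀ q : Fin h → ι, Injective q →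
      (fun m => y (q m)) ∈ ρ ∨ ∃ t ∈ R, (fun m => t (q m)) ∉ ρ) : y ∈ relClosure ρ R := by
  intro q hR
  by_cases hq : Injective q
  · exact (hy q hq).resolve_right fun ⟨t, ht, htq⟩ => htq (hR t ht)
  · exact hρ.comp_mem_of_not_injective y hq

theorem IsCentral.preservesRel_extend (hρ : IsCentral ρ) (hc : c ∈ center ρ) {X : ι → N → A}
    (hX : Injective X) {y : ι → A} (hy : y ∈ relClosure ρ (Set.range fun j i => X i j)) :
    PreservesRel (extend X y fun _ => c) ρ := by
  refine hρ.preservesRel_of_forall hc (P := fun z => ∃ i, X i = z)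
    (fun z hz => extend_apply' _ _ _ hz) fun a ha hall => ?_
  choose q hq using hall
  simp only [← hq, hX.extend_apply]
  refine hy q ?_
  rintro _ ⟨j, rfl⟩
  simpa only [hq] using ha j

/-- The rows of the matrix whose columns are all the tuples of `R`. -/
def rows (R : Set (ι → A)) : ι → R → A := fun i t => t.1 i

theorem rows_injective {R : Set (ι → A)} [DecidableEq ι] {a b : A} (hab : a ≠ b)
    (hR : ∀ i, update (fun _ => a) i b ∈ R) : Injective (rows R) := by
  intro i j hij
  by_contra hne
  have := congrFun hij ⟨_, hR i⟩
  simp [rows, Ne.symm hne, hab.symm] at this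

theorem IsCentral.rows_injective (hσ : IsCentral σ) : Injective (rows σ) := by
  obtain ⟨c, hc⟩ := hσ.center_nonempty
  obtain ⟨a, ha⟩ := hσ.exists_ne c
  exact CloneTheory.rows_injective ha fun i => hσ.mem_of_mem_center i (by simpa using hc)

/-- The operation that sends the `i`-th row of the matrix of `R` to `w i`, and everything else to
`c`. -/
noncomputable def rowOp (R : Set (ι → A)) (w : ι → A) (c : A) : (R → A) → A :=
  extend (rows R) w fun _ => c

theorem mem_of_preservesRel_rowOp {R : Set (ι → A)} (hR : Injective (rows R)) {w : ι → A}
    (hw : PreservesRel (rowOp R w c) R) : w ∈ R := by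
  have hrow : (fun i => rowOp R w c fun t => t.1 i) = w := funext fun i => hR.extend_apply w _ i
  exact hrow ▸ hw (fun t => t.1) fun t => t.2

theorem IsCentral.preservesRel_rowOp (hρ : IsCentral ρ) (hc : c ∈ center ρ) {R : Set (ι → A)}
    (hR : Injective (rows R)) {w : ι → A} (hw : w ∈ relClosure ρ R) :
    PreservesRel (rowOp R w c) ρ := by
  refine hρ.preservesRel_extend hc hR ?_
  have hcols : (Set.range fun (t : R) i => rows R i t) = R := Subtype.range_coe
  rwa [hcols]

theorem IsCentral.relClosure_subset [Finite A] [Finite ι] (hρ : IsCentral ρ) {R : Set (ι → A)}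
    (hinv : (Pol {⟨h, ρ⟩}).Invariant R) (hne : R.Nonempty) (hR : Injective (rows R)) :
    relClosure ρ R ⊆ R := by
  intro w hw
  obtain ⟨c, hc⟩ := hρ.center_nonempty
  have : Nonempty R := hne.to_subtype
  refine mem_of_preservesRel_rowOp hR (c := c) (hinv.preservesRel (mem_opsOn_pol.2 ?_))
  simpa using hρ.preservesRel_rowOp hc hR hw

end RowOp

section Selection

variable {A ι : Type*} {h s : ℕ} {ρ : Set (Fin h → A)} {σ : Set (Fin s → A)}

theorem not_injective_of_lt (e : s < h) (q : Fin h → Fin s) : ¬ Injective q := fun hq =>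
  e.not_ge (by simpa using Fintype.card_le_of_injective q hq)

theorem exists_perm_castLE (e : h ≤ s) {q : Fin h → Fin s} (hq : Injective q) :
    ∃ π : Equiv.Perm (Fin s), ∀ i, π (Fin.castLE e i) = q i := by
  have := Equiv.Perm.isMultiplyPretransitive (Fin s) h
  obtain ⟨π, hπ⟩ := MulAction.exists_smul_eq (Equiv.Perm (Fin s)) (Fin.castLEEmb e) ⟨q, hq⟩
  exact ⟨π, fun i => DFunLike.congr_fun hπ i⟩

theorem IsCentral.exists_mem_comp_notMem (hσ : IsCentral σ) {e : h ≤ s}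
    (hsub : ¬ σ ⊆ extendArity e ρ) {q : Fin h → Fin s} (hq : Injective q) :
    ∃ t ∈ σ, (fun i => t (q i)) ∉ ρ := by
  obtain ⟨t, htσ, htρ⟩ := Set.not_subset.1 hsub
  obtain ⟨π, hπ⟩ := exists_perm_castLE e hq
  exact ⟨fun i => t (π.symm i), hσ.comp_mem htσ _, by simpa only [← hπ, Equiv.symm_apply_apply]⟩

theorem IsCentral.exists_mem_comp_eq (hσ : IsCentral σ) {q : ι → Fin s} (hq : Injective q)
    {z : Fin s} (hz : ∀ i, q i ≠ z) (v : ι → A) : ∃ t ∈ σ, (fun i => t (q i)) = v := by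
  obtain ⟨c, hc⟩ := hσ.center_nonempty
  refine ⟨extend q v fun _ => c, hσ.mem_of_mem_center z ?_, funext fun i => hq.extend_apply v _ i⟩
  rwa [extend_apply' _ _ _ fun ⟨i, hi⟩ => hz i hi]

theorem IsCentral.not_subset_extendArity (hρ : IsCentral ρ) (hσ : IsCentral σ) (e : h < s) :
    ¬ σ ⊆ extendArity e.le ρ := by
  obtain ⟨v, hv⟩ := hρ.exists_notMem
  obtain ⟨t, ht, rfl⟩ := hσ.exists_mem_comp_eq (Fin.castLE_injective e.le) (z := ⟨h, e⟩)
    (fun i => Fin.ne_of_val_ne i.2.ne) v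
  exact fun hsub => hv (hsub ht)

theorem center_subset_center (hρ : IsCentral ρ) (e : h ≤ s) (hsub : extendArity e ρ ⊆ σ) :
    center ρ ⊆ center σ := by
  rintro c hc x ⟨i, hi, rfl⟩
  obtain rfl : Fin.castLE e ⟨0, hρ.arity_pos⟩ = i := Fin.ext hi.symm
  exact hsub (hρ.mem_of_mem_center ⟨0, hρ.arity_pos⟩ hc)

end Selection

section CommonCenter

variable {A : Type*} {h s : ℕ} {ρ : Set (Fin h → A)} {σ : Set (Fin s → A)} {c : A}
  {G : OpClone A}

theorem OpClone.exists_mem_ops_map_notMem (hρ : IsCentral ρ) (hσ : IsCentral σ)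
    (hcρ : c ∈ center ρ) (hcσ : c ∈ center σ) (hG : Pol {⟨h, ρ⟩, ⟨s, σ⟩} ≤ G) {n m : ℕ}
    (hm : 0 < m) {f : (Fin n → A) → A} (hf : f ∈ G.ops n) (hfσ : ¬ PreservesRel f σ)
    {X : Fin m → Fin s → A} (hX : Injective fun i j => X j i)
    (hσX : σ ⊆ relClosure ρ (Set.range X)) : ∃ F ∈ G.ops m, (fun i => F fun j => X j i) ∉ σ := by
  simp only [PreservesRel, not_forall] at hfσ
  obtain ⟨a, haσ, hfa⟩ := hfσ
  let K : Fin n → (Fin m → A) → A := fun l => extend (fun i j => X j i) (a l) fun _ => c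
  have hK : ∀ l, K l ∈ G.ops m := fun l => hG m (mem_ops_pol_pair.2
    ⟨hm, hρ.preservesRel_extend hcρ hX (hσX (haσ l)),
      hσ.preservesRel_extend hcσ hX fun q _ => hσ.comp_mem (haσ l) q⟩)
  have hKX : ∀ l i, K l (fun j => X j i) = a l i := fun l i => hX.extend_apply (a l) _ i
  exact ⟨_, G.comp_mem n m f K hf hK, by simpa only [hKX] using hfa⟩

variable [Finite A]

/- The operations `F` are appended as control arguments: a tuple `z` is evaluated by `g` only if its
last entries are the values of the `F`s at its first ones, and a matrix in `σ` on which `g` leaves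
`σ` never passes this test. -/
theorem OpClone.mem_ops_of_forall_exists_notMem (hρ : IsCentral ρ) (hσ : IsCentral σ)
    (hcρ : c ∈ center ρ) (hcσ : c ∈ center σ) (hG : Pol {⟨h, ρ⟩, ⟨s, σ⟩} ≤ G) {m : ℕ} (hm : 0 < m)
    {g : (Fin m → A) → A} (hg : PreservesRel g ρ)
    (hF : ∀ X : Fin m → Fin s → A, (∀ j, X j ∈ σ) → (fun i => g fun j => X j i) ∉ σ →
      ∃ F ∈ G.ops m, (fun i => F fun j => X j i) ∉ σ) : g ∈ G.ops m := by
  classical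
  let Bad := {X : Fin m → Fin s → A // (∀ j, X j ∈ σ) ∧ (fun i => g fun j => X j i) ∉ σ}
  choose F hFG hFX using fun X : Bad => hF X.1 X.2.1 X.2.2
  let P : (Fin m ⊕ Bad → A) → Prop := fun z => ∀ X, z (Sum.inr X) = F X fun j => z (Sum.inl j)
  let H : (Fin m ⊕ Bad → A) → A := fun z => if P z then g fun j => z (Sum.inl j) else c
  have hHP : ∀ {k : ℕ} {b : Fin m ⊕ Bad → Fin k → A}, (∀ i, P fun j => b j i) →
      (fun i => H fun j => b j i) = fun i => g fun j => b (Sum.inl j) i :=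
    fun hP => funext fun i => if_pos (hP i)
  have hHρ : PreservesRel H ρ := by
    refine hρ.preservesRel_of_forall hcρ (fun z hz => if_neg hz) fun b hb hP => ?_
    rw [hHP hP]
    exact hg _ fun j => hb _
  have hHσ : PreservesRel H σ := by
    refine hσ.preservesRel_of_forall hcσ (fun z hz => if_neg hz) fun b hb hP => ?_
    rw [hHP hP]
    by_contra hbad
    let X : Bad := ⟨fun j => b (Sum.inl j), fun j => hb _, hbad⟩
    have hbX : (fun i => F X fun j => X.1 j i) = b (Sum.inr X) := funext fun i => (hP i X).symm
    exact hFX X (hbX ▸ hb (Sum.inr X))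
  have : Nonempty (Fin m ⊕ Bad) := ⟨Sum.inl ⟨0, hm⟩⟩
  have hcomp := OpClone.comp_mem_of_mem_opsOn
    (OpClone.opsOn_mono hG (mem_opsOn_pol_pair.2 ⟨hHρ, hHσ⟩))
    (F := Sum.elim (fun j x => x j) F) (Sum.rec (G.proj_mem m) hFG)
  simpa [H, P] using hcomp

theorem isSubmaximal_of_common_center (hρ : IsCentral ρ) (hσ : IsCentral σ)
    (hcρ : c ∈ center ρ) (hcσ : c ∈ center σ)
    (hdich : ∀ q : Fin h → Fin s, Injective q →
      (∀ t ∈ σ, (fun i => t (q i)) ∈ ρ) ∨ ∀ t, (fun i => t (q i)) ∈ ρ → t ∈ σ)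
    {w : Fin s → A} (hwσ : w ∉ σ) (hw : w ∈ relClosure ρ σ) : IsSubmaximal ρ σ := by
  have : Nonempty σ := hσ.nonempty.to_subtype
  refine isSubmaximal_of_forall_le (hρ.preservesRel_rowOp hcρ hσ.rows_injective hw)
    (fun hf => hwσ (mem_of_preservesRel_rowOp hσ.rows_injective hf))
    fun G hG n f hf hfσ m g hg => ?_
  obtain ⟨hm, hgρ⟩ := mem_ops_pol_singleton.1 hg
  refine OpClone.mem_ops_of_forall_exists_notMem hρ hσ hcρ hcσ hG hm hgρ fun X _ hgX =>
    OpClone.exists_mem_ops_map_notMem hρ hσ hcρ hcσ hG hm hf hfσ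
      (fun i i' hii => hσ.totallyReflexive.injective_of_notMem hgX (congrArg g hii))
      fun t ht => hρ.totallyReflexive.mem_relClosure fun q hq => ?_
  refine (hdich q hq).imp (fun hσρ => hσρ t ht) fun hρσ => ?_
  by_contra! hXq
  exact hgX (hρσ _ (hgρ (fun j i => X j (q i)) fun j => hXq _ ⟨j, rfl⟩))

theorem isSubmaximal_of_lt (hρ : IsCentral ρ) (hσ : IsCentral σ) (e : s < h)
    (hmeet : (center ρ ∩ center σ).Nonempty) : IsSubmaximal ρ σ := by
  obtain ⟨c, hcρ, hcσ⟩ := hmeet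
  obtain ⟨w, hw⟩ := hσ.exists_notMem
  exact isSubmaximal_of_common_center hρ hσ hcρ hcσ
    (fun q hq => absurd hq (not_injective_of_lt e q)) hw
    (hρ.totallyReflexive.mem_relClosure fun q hq => absurd hq (not_injective_of_lt e q))

theorem isSubmaximal_of_extendArity_ssubset (hρ : IsCentral ρ) (hσ : IsCentral σ) (e : h ≤ s)
    (hsub : extendArity e ρ ⊂ σ) : IsSubmaximal ρ σ := by
  obtain ⟨c, hc⟩ := hρ.center_nonempty
  obtain ⟨w, hw⟩ := hσ.exists_notMem
  refine isSubmaximal_of_common_center hρ hσ hc (center_subset_center hρ e hsub.subset hc)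
    (fun q hq => Or.inr fun t ht => ?_) hw
    (hρ.totallyReflexive.mem_relClosure fun q hq =>
      Or.inr (hσ.exists_mem_comp_notMem hsub.not_subset hq))
  obtain ⟨π, hπ⟩ := exists_perm_castLE e hq
  have hmem : (fun i => t (π i)) ∈ σ :=
    hsub.subset (by simpa only [extendArity, Set.mem_ofPred_eq, hπ] using ht)
  simpa using hσ.comp_mem hmem π.symm

theorem isSubmaximal_of_ssubset {σ : Set (Fin h → A)} (hρ : IsCentral ρ) (hσ : IsCentral σ)
    (hsub : σ ⊂ ρ) : IsSubmaximal ρ σ := by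
  obtain ⟨c, hc⟩ := hσ.center_nonempty
  obtain ⟨w, hwρ, hw⟩ := Set.exists_of_ssubset hsub
  exact isSubmaximal_of_common_center hρ hσ (fun x hx => hsub.subset (hc x hx)) hc
    (fun q _ => Or.inl fun t ht => hρ.comp_mem (hsub.subset ht) q) hw
    fun q _ => hρ.comp_mem hwρ q

end CommonCenter

section Unary

variable {A N : Type*} {ρ : Set (Fin 2 → A)} {σ : Set (Fin 1 → A)}

theorem mem_fin_one_iff {x : Fin 1 → A} : x ∈ σ ↔ x 0 ∈ unarySet σ := by
  have hx : x = ![x 0] := funext fun i => by fin_cases i; rfl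
  rw [unarySet, Set.mem_ofPred_eq, ← hx]

theorem mem_fin_two_iff {x : Fin 2 → A} : x ∈ ρ ↔ ![x 0, x 1] ∈ ρ := by
  have hx : x = ![x 0, x 1] := funext fun i => by fin_cases i <;> rfl
  rw [← hx]

theorem preservesRel_unary_iff {f : (N → A) → A} :
    PreservesRel f σ ↔ ∀ x : N → A, (∀ j, x j ∈ unarySet σ) → f x ∈ unarySet σ :=
  ⟨fun hf x hx => mem_fin_one_iff.1 (hf (fun j _ => x j) fun j => mem_fin_one_iff.2 (hx j)),
    fun hf a ha => mem_fin_one_iff.2 (hf (fun j => a j 0) fun j => mem_fin_one_iff.1 (ha j))⟩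

theorem preservesRel_binary_iff {f : (N → A) → A} :
    PreservesRel f ρ ↔ ∀ x y : N → A, (∀ j, ![x j, y j] ∈ ρ) → ![f x, f y] ∈ ρ :=
  ⟨fun hf x y hxy => by simpa using mem_fin_two_iff.1 (hf (fun j => ![x j, y j]) hxy),
    fun hf a ha => mem_fin_two_iff.2
      (hf (fun j => a j 0) (fun j => a j 1) fun j => mem_fin_two_iff.1 (ha j))⟩

theorem center_eq_unarySet : center σ = unarySet σ := by
  refine Set.Subset.antisymm (fun a ha => ha _ ⟨0, rfl, rfl⟩) ?_
  rintro a ha x ⟨i, -, rfl⟩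
  rwa [mem_fin_one_iff, Subsingleton.elim 0 i]

theorem IsCentral.pair_symm (hρ : IsCentral ρ) {a b : A} (hab : ![a, b] ∈ ρ) : ![b, a] ∈ ρ := by
  simpa using mem_fin_two_iff.1 (hρ.comp_mem hab (Equiv.swap 0 1))

theorem TotallyReflexive.pair_self (hρ : TotallyReflexive ρ) (a : A) : ![a, a] ∈ ρ :=
  hρ _ ⟨0, 1, by simp, rfl⟩

theorem isRelChain_two_iff {B : Set A} : IsRelChain ρ B ↔ ∀ a ∈ B, ∀ b ∈ B, ![a, b] ∈ ρ :=
  ⟨fun hB a ha b hb => hB _ fun i => by fin_cases i <;> simpa,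
    fun hB _ hx => mem_fin_two_iff.2 (hB _ (hx 0) _ (hx 1))⟩

theorem exists_adjacent_of_isRelChain [Finite A] {U S : Set A}
    (hmax : ∀ B : Set A, Maximal (IsRelChain ρ) B → (B ∩ U).Nonempty) (hS : IsRelChain ρ S) :
    ∃ u ∈ U, ∀ z ∈ S, ![z, u] ∈ ρ := by
  obtain ⟨B, hSB, hB⟩ := (Set.toFinite {B : Set A | IsRelChain ρ B}).exists_le_maximal hS
  obtain ⟨u, huB, huU⟩ := hmax B hB
  exact ⟨u, huU, fun z hz => isRelChain_two_iff.1 hB.prop z (hSB hz) u huB⟩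

/-- The common neighbourhood of a tuple in the power `N → A` of the graph `ρ`. -/
def neighbours (ρ : Set (Fin 2 → A)) (x : N → A) : Set (N → A) :=
  {z | ∀ j, ![z j, x j] ∈ ρ}

theorem neighbours_subset_of_mem (hcn : commonNeighbour ρ σ ⊆ ρ)
    {x y : N → A} (hx : ∀ j, x j ∈ unarySet σ) (hxy : y ∈ neighbours ρ x) :
    neighbours ρ x ⊆ neighbours ρ y :=
  fun _ hz j => hcn ⟨x j, hx j, hz j, hxy j⟩

theorem exists_adjacent_image_neighbours [Finite A] (hcn : commonNeighbour ρ σ ⊆ ρ)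
    (hmax : ∀ B : Set A, Maximal (IsRelChain ρ) B → (B ∩ unarySet σ).Nonempty)
    {g : (N → A) → A} (hg : PreservesRel g ρ) {x : N → A} (hx : ∀ j, x j ∈ unarySet σ) :
    ∃ u ∈ unarySet σ, ∀ z ∈ neighbours ρ x, ![g z, u] ∈ ρ := by
  have hchain : IsRelChain ρ (g '' neighbours ρ x) := by
    rw [isRelChain_two_iff]
    rintro _ ⟨y, hy, rfl⟩ _ ⟨z, hz, rfl⟩
    exact preservesRel_binary_iff.1 hg y z fun j => hcn ⟨x j, hx j, hy j, hz j⟩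
  obtain ⟨u, hu, hadj⟩ := exists_adjacent_of_isRelChain hmax hchain
  exact ⟨u, hu, fun z hz => hadj _ ⟨z, hz, rfl⟩⟩

/- On `σ`, the extension takes a value depending on the neighbourhood only; adjacent tuples of `σ`
have equal neighbourhoods, so `ρ` is still preserved. -/
theorem exists_preservesRel_extension [Finite A] (hρ : IsCentral ρ)
    (hcn : commonNeighbour ρ σ ⊆ ρ)
    (hmax : ∀ B : Set A, Maximal (IsRelChain ρ) B → (B ∩ unarySet σ).Nonempty)
    {g : (N → A) → A} (hg : PreservesRel g ρ) {b : A} (hb : b ∉ unarySet σ) :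
    ∃ H : (Option N → A) → A, PreservesRel H ρ ∧ PreservesRel H σ ∧
      ∀ x : N → A, H (fun o => o.elim b x) = g x := by
  classical
  have : Nonempty A := ⟨b⟩
  have hex : ∀ S, (∃ x : N → A, (∀ j, x j ∈ unarySet σ) ∧ neighbours ρ x = S) →
      ∃ u, u ∈ unarySet σ ∧ ∀ z ∈ S, ![g z, u] ∈ ρ := by
    rintro S ⟨x, hx, rfl⟩
    exact exists_adjacent_image_neighbours hcn hmax hg hx
  choose! v hv using hex
  replace hv := fun x hx => hv _ ⟨x, hx, rfl⟩
  have hv_eq : ∀ x y : N → A, (∀ j, x j ∈ unarySet σ) → (∀ j, y j ∈ unarySet σ) →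
      (∀ j, ![x j, y j] ∈ ρ) → v (neighbours ρ x) = v (neighbours ρ y) := fun x y hx hy hxy =>
    congrArg v ((neighbours_subset_of_mem hcn hx fun j => hρ.pair_symm (hxy j)).antisymm
      (neighbours_subset_of_mem hcn hy hxy))
  refine ⟨fun z => if z none ≠ b ∧ ∀ j, z (some j) ∈ unarySet σ
    then v (neighbours ρ fun j => z (some j)) else g fun j => z (some j), ?_, ?_, by simp⟩
  · rw [preservesRel_binary_iff]
    intro x y hxy
    split_ifs with hx hy hy
    · rw [hv_eq _ _ hx.2 hy.2 fun j => hxy _]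
      exact hρ.totallyReflexive.pair_self _
    · exact hρ.pair_symm ((hv _ hx.2).2 _ fun j => hρ.pair_symm (hxy _))
    · exact (hv _ hy.2).2 _ fun j => hxy _
    · exact preservesRel_binary_iff.1 hg _ _ fun j => hxy _
  · rw [preservesRel_unary_iff]
    intro x hx
    rw [if_pos ⟨fun heq => hb (heq ▸ hx none), fun j => hx _⟩]
    exact (hv _ fun j => hx _).1

theorem isSubmaximal_of_chains [Finite A] (hρ : IsCentral ρ) (hσ : IsCentral σ)
    (hcn : commonNeighbour ρ σ ⊆ ρ)
    (hmax : ∀ B : Set A, Maximal (IsRelChain ρ) B → (B ∩ unarySet σ).Nonempty) :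
    IsSubmaximal ρ σ := by
  obtain ⟨w, hw⟩ := hσ.exists_notMem
  refine isSubmaximal_of_forall_le (N := Unit) (f := fun _ => w 0)
    (preservesRel_binary_iff.2 fun _ _ _ => hρ.totallyReflexive.pair_self _)
    (fun hf => hw ?_) fun G hG n f hf hfσ m g hg => ?_
  · obtain ⟨a, ha⟩ := hσ.center_nonempty
    rw [center_eq_unarySet] at ha
    exact mem_fin_one_iff.2 (preservesRel_unary_iff.1 hf (fun _ => a) fun _ => ha)
  obtain ⟨hm, hgρ⟩ := mem_ops_pol_singleton.1 hg
  simp only [preservesRel_unary_iff, not_forall] at hfσ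
  obtain ⟨a, ha, hb⟩ := hfσ
  have hconst : (fun _ : Fin m → A => f a) ∈ G.ops m :=
    G.comp_mem n m f (fun l _ => a l) hf fun l => hG m (mem_ops_pol_pair.2 ⟨hm,
      preservesRel_binary_iff.2 fun _ _ _ => hρ.totallyReflexive.pair_self _,
      preservesRel_unary_iff.2 fun _ _ => ha l⟩)
  obtain ⟨H, hHρ, hHσ, hHg⟩ := exists_preservesRel_extension hρ hcn hmax hgρ hb
  have hcomp := OpClone.comp_mem_of_mem_opsOn
    (OpClone.opsOn_mono hG (mem_opsOn_pol_pair.2 ⟨hHρ, hHσ⟩))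
    (F := fun o x => o.elim (f a) x) (Option.rec hconst (G.proj_mem m))
  simpa only [hHg] using hcomp

end Unary

section Completion

variable {A ι κ : Type*} {n : ℕ} {ρ : Set (Fin (n + 1) → A)} {σ : Set (Fin 1 → A)}

/-- The tuples whose subtuples `y ∘ p k` are all completed to tuples of `ρ` by the same entry from
the unary relation `σ`. -/
def completionRel (ρ : Set (Fin (n + 1) → A)) (σ : Set (Fin 1 → A)) (p : κ → Fin n → ι) :
    Set (ι → A) :=
  {y | ∃ u ∈ unarySet σ, ∀ k, Matrix.vecCons u (fun l => y (p k l)) ∈ ρ}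

theorem PreservesRel.completionRel {N : Type*} {f : (N → A) → A} (hρ : PreservesRel f ρ)
    (hσ : PreservesRel f σ) (p : κ → Fin n → ι) : PreservesRel f (completionRel ρ σ p) := by
  intro a ha
  choose u hu hρu using ha
  refine ⟨f u, preservesRel_unary_iff.1 hσ u hu, fun k => ?_⟩
  convert hρ _ fun j => hρu j k using 1
  funext i
  cases i using Fin.cases <;> rfl

theorem IsCentral.mem_completionRel (hρ : IsCentral ρ) (hn : 1 ≤ n) {u : A} (hu : u ∈ unarySet σ)
    (p : κ → Fin n → ι) {y : ι → A} (hy : ∀ i, y i ∈ {u} ∪ center ρ) : y ∈ completionRel ρ σ p := by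
  have hchain := hρ.isRelChain_union_center
    (hρ.totallyReflexive.isRelChain_singleton (Nat.succ_le_succ hn) u)
  exact ⟨u, hu, fun k => hchain _ (Fin.cases (Or.inl rfl) fun l => hy _)⟩

theorem IsSubmaximal.relClosure_completionRel_subset [Finite A] [Finite ι] (hcov : IsSubmaximal ρ σ)
    (hρ : IsCentral ρ) (hσ : IsCentral σ) (hn : 1 ≤ n)
    (hdisj : ¬ (center ρ ∩ unarySet σ).Nonempty) (p : κ → Fin n → ι) :
    relClosure ρ (completionRel ρ σ p) ⊆ completionRel ρ σ p := by
  classical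
  obtain ⟨c, hc⟩ := hρ.center_nonempty
  obtain ⟨u, hu⟩ := hσ.center_nonempty
  rw [center_eq_unarySet] at hu
  have hcσ : c ∉ unarySet σ := fun hcσ => hdisj ⟨c, hc, hcσ⟩
  have hconst : (fun _ => c) ∈ completionRel ρ σ p :=
    hρ.mem_completionRel hn hu p fun _ => Or.inr hc
  refine hρ.relClosure_subset ?_ ⟨_, hconst⟩ (rows_injective (a := c) (b := u)
    (fun hcu => hcσ (hcu ▸ hu)) fun i => hρ.mem_completionRel hn hu p fun j => ?_)
  · refine hcov.invariant (N := Unit) (f := fun _ => c) (fun m f hf => ?_)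
      (fun _ _ => hρ.mem_of_mem_center 0 hc)
      (fun hf => hcσ (preservesRel_unary_iff.1 hf (fun _ => u) fun _ => hu)) fun _ _ => hconst
    obtain ⟨-, hfρ, hfσ⟩ := mem_ops_pol_pair.1 hf
    exact hfρ.completionRel hfσ p
  · by_cases hj : j = i
    · exact Or.inl (by simp [hj])
    · exact Or.inr (by simpa [hj] using hc)

theorem exists_common_block {q : Fin (n + 1) → κ × Fin n} (hq : Injective q) {k : κ}
    (hk : ∀ l, (k, l) ∈ Set.range q) : ∃ m₀, (q m₀).1 ≠ k ∧ ∀ m ≠ m₀, (q m).1 = k := by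
  obtain ⟨m₀, hm₀⟩ : ∃ m₀, (q m₀).1 ≠ k := by
    by_contra! hall
    exact not_injective_of_lt n.lt_succ_self (fun m => (q m).2) fun m m' hm =>
      hq (Prod.ext ((hall m).trans (hall m').symm) hm)
  choose r hr using hk
  have hinj : Injective (Fin.cons m₀ r : Fin (n + 1) → Fin (n + 1)) := by
    refine Fin.cons_injective_iff.2 ⟨?_, fun l l' hl => ?_⟩
    · rintro ⟨l, rfl⟩
      exact hm₀ (congrArg Prod.fst (hr l))
    · simpa [hr] using congrArg q hl
  refine ⟨m₀, hm₀, fun m hm => ?_⟩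
  obtain ⟨i, rfl⟩ := Finite.injective_iff_surjective.1 hinj m
  cases i using Fin.cases with
  | zero => exact absurd rfl hm
  | succ l => exact congrArg Prod.fst (hr l)

theorem IsCentral.exists_mem_completionRel_comp_notMem (hρ : IsCentral ρ) (hσ : IsCentral σ)
    (hn : 2 ≤ n) (hcompl : ∀ x : Fin n → A, ∃ u ∈ unarySet σ, Matrix.vecCons u x ∈ ρ)
    {q : Fin (n + 1) → κ × Fin n} (hq : Injective q) :
    ∃ t ∈ completionRel ρ σ (Prod.mk : κ → Fin n → κ × Fin n), (fun m => t (q m)) ∉ ρ := by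
  classical
  obtain ⟨v, hv⟩ := hρ.exists_notMem
  obtain ⟨c, hc⟩ := hρ.center_nonempty
  by_cases hfull : ∃ k, ∀ l, (k, l) ∈ Set.range q
  · obtain ⟨k, hk⟩ := hfull
    obtain ⟨m₀, hm₀, hm⟩ := exists_common_block hq hk
    let t : κ × Fin n → A := fun j => if j.1 = k then extend q v (fun _ => c) j else v m₀
    have htq : (fun m => t (q m)) = v := by
      funext m
      by_cases h : m = m₀
      · simp [t, h, hm₀]
      · simp [t, hm m h, hq.extend_apply]
    obtain ⟨u, hu, huk⟩ := hcompl fun l => t (k, l)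
    refine ⟨t, ⟨u, hu, fun k' => ?_⟩, htq ▸ hv⟩
    by_cases hkk : k' = k
    · rwa [hkk]
    · exact hρ.totallyReflexive _ ⟨Fin.succ ⟨0, by omega⟩, Fin.succ ⟨1, by omega⟩,
        by simp, by simp [t, hkk]⟩
  · push Not at hfull
    obtain ⟨u, hu⟩ := hσ.center_nonempty
    rw [center_eq_unarySet] at hu
    refine ⟨extend q v fun _ => c, ⟨u, hu, fun k => ?_⟩, by simpa only [hq.extend_apply]⟩
    obtain ⟨l, hl⟩ := hfull k
    exact hρ.mem_of_mem_center l.succ (by simpa [extend_apply' _ _ _ hl] using hc)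

theorem IsSubmaximal.center_inter_unarySet_nonempty [Finite A] (hcov : IsSubmaximal ρ σ)
    (hρ : IsCentral ρ) (hσ : IsCentral σ) (hn : 2 ≤ n) : (center ρ ∩ unarySet σ).Nonempty := by
  by_contra hdisj
  have hn₁ : 1 ≤ n := by omega
  have hcompl : ∀ x : Fin n → A, ∃ u ∈ unarySet σ, Matrix.vecCons u x ∈ ρ := by
    intro x
    obtain ⟨u, hu, hux⟩ := hcov.relClosure_completionRel_subset hρ hσ hn₁ hdisj
      (fun (_ : Unit) l => l) (hρ.totallyReflexive.mem_relClosure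
        (y := x) fun q hq => absurd hq (not_injective_of_lt n.lt_succ_self q))
    exact ⟨u, hu, hux ()⟩
  obtain ⟨u, hu, hall⟩ := hcov.relClosure_completionRel_subset hρ hσ hn₁ hdisj Prod.mk
    (hρ.totallyReflexive.mem_relClosure (y := fun j : (Fin n → A) × Fin n => j.1 j.2) fun q hq =>
      Or.inr (hρ.exists_mem_completionRel_comp_notMem hσ hn hcompl hq))
  refine hdisj ⟨u, ?_, hu⟩
  rintro x ⟨i, hi, rfl⟩
  obtain rfl : i = 0 := Fin.ext hi
  convert hall fun l => x l.succ using 1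
  exact (Matrix.cons_head_tail x).symm

end Completion

section Adjacency

variable {A : Type*} [Finite A] {ρ : Set (Fin 2 → A)} {σ : Set (Fin 1 → A)}

theorem IsSubmaximal.exists_adjacent (hcov : IsSubmaximal ρ σ) (hρ : IsCentral ρ)
    (hσ : IsCentral σ) (hdisj : ¬ (center ρ ∩ unarySet σ).Nonempty) {S : Set A}
    (hS : IsRelChain ρ S) : ∃ u ∈ unarySet σ, ∀ z ∈ S, ![u, z] ∈ ρ := by
  obtain ⟨u, hu, hadj⟩ := hcov.relClosure_completionRel_subset hρ hσ le_rfl hdisj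
    (fun (z : S) _ => z) (a := fun z : S => z.1) fun q _ => hS _ fun i => (q i).2
  exact ⟨u, hu, fun z hz => by simpa using mem_fin_two_iff.1 (hadj ⟨z, hz⟩)⟩

/- If `x ∉ ρ` has a common neighbour in `σ`, then so does every tuple with the two entries of `x`,
so no binary constraint holds throughout the relation of having a common neighbour in `σ`. -/
theorem IsSubmaximal.commonNeighbour_subset (hcov : IsSubmaximal ρ σ) (hρ : IsCentral ρ)
    (hσ : IsCentral σ) (hdisj : ¬ (center ρ ∩ unarySet σ).Nonempty) :
    commonNeighbour ρ σ ⊆ ρ := by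
  classical
  rintro x ⟨w, hw, hx₀, hx₁⟩
  by_contra hx
  obtain ⟨u, hu, hadj⟩ := hcov.relClosure_completionRel_subset hρ hσ le_rfl hdisj
    (fun (a : A) (_ : Fin 1) => a) (a := id) (hρ.totallyReflexive.mem_relClosure fun q hq => by
      refine Or.inr ⟨fun a => if a = q 0 then x 0 else x 1, ⟨w, hw, fun a => ?_⟩, ?_⟩
      · rw [mem_fin_two_iff]
        apply hρ.pair_symm
        dsimp
        split_ifs <;> assumption
      · rw [mem_fin_two_iff] at hx ⊢
        simpa [hq.ne (one_ne_zero : (1 : Fin 2) ≠ 0)] using hx)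
  refine hdisj ⟨u, ?_, hu⟩
  rintro y ⟨i, hi, rfl⟩
  obtain rfl : i = 0 := Fin.ext hi
  exact mem_fin_two_iff.2 (by simpa using mem_fin_two_iff.1 (hadj (y 1)))

theorem IsSubmaximal.eq_commonNeighbour (hcov : IsSubmaximal ρ σ) (hρ : IsCentral ρ)
    (hσ : IsCentral σ) (hdisj : ¬ (center ρ ∩ unarySet σ).Nonempty) :
    ρ = commonNeighbour ρ σ := by
  refine Set.Subset.antisymm (fun x hx => ?_) (hcov.commonNeighbour_subset hρ hσ hdisj)
  have hchain : IsRelChain ρ (Set.range x) := fun y hy => by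
    choose q hq using hy
    simpa only [hq] using hρ.comp_mem hx q
  obtain ⟨u, hu, hadj⟩ := hcov.exists_adjacent hρ hσ hdisj hchain
  exact ⟨u, hu, hρ.pair_symm (hadj _ ⟨0, rfl⟩), hρ.pair_symm (hadj _ ⟨1, rfl⟩)⟩

theorem IsSubmaximal.maximal_chain_inter_nonempty (hcov : IsSubmaximal ρ σ) (hρ : IsCentral ρ)
    (hσ : IsCentral σ) (hdisj : ¬ (center ρ ∩ unarySet σ).Nonempty) {B : Set A}
    (hB : Maximal (IsRelChain ρ) B) : (B ∩ unarySet σ).Nonempty := by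
  obtain ⟨u, hu, hadj⟩ := hcov.exists_adjacent hρ hσ hdisj hB.prop
  have hinsert : IsRelChain ρ (insert u B) := by
    rw [isRelChain_two_iff]
    rintro a (rfl | ha) b (rfl | hb)
    · exact hρ.totallyReflexive.pair_self _
    · exact hadj b hb
    · exact hρ.pair_symm (hadj a ha)
    · exact isRelChain_two_iff.1 hB.prop a ha b hb
  exact ⟨u, hB.le_of_ge hinsert (Set.subset_insert u B) (Set.mem_insert u B), hu⟩

end Adjacency

section Link

variable {A I I' : Type*} {h s : ℕ} {ρ : Set (Fin h → A)} {σ : Set (Fin s → A)} {B : Set A}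
  {c e : A}

/-- The pairs of families such that some element may be added both to the first family as far as
`ρ` is concerned and to the second one as far as `σ` is concerned. -/
def linkRel (ρ : Set (Fin h → A)) (σ : Set (Fin s → A)) (I I' : Type*) : Set (I ⊕ I' → A) :=
  {γ | (centerOver ρ (Set.range fun i => γ (Sum.inl i)) ∩
    centerOver σ (Set.range fun i => γ (Sum.inr i))).Nonempty}

theorem invariant_linkRel (ρ : Set (Fin h → A)) (σ : Set (Fin s → A)) (I I' : Type*) :
    (Pol {⟨h, ρ⟩, ⟨s, σ⟩}).Invariant (linkRel ρ σ I I') := by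
  intro n f hf a ha
  obtain ⟨-, hfρ, hfσ⟩ := mem_ops_pol_pair.1 hf
  choose u huρ huσ using ha
  exact ⟨f u, hfρ.mem_centerOver huρ, hfσ.mem_centerOver huσ⟩

theorem IsCentral.mem_linkRel_of_chain_right (hρ : IsCentral ρ) (hc : c ∈ center ρ)
    (hB : IsRelChain σ B) (hcB : c ∈ B) {γ : I ⊕ I' → A} (hγ : ∀ i, γ (Sum.inr i) ∈ B) :
    γ ∈ linkRel ρ σ I I' :=
  ⟨c, hρ.center_subset_centerOver hc, hB.mem_centerOver hcB (Set.range_subset_iff.2 hγ)⟩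

theorem IsCentral.mem_linkRel_of_chain_left (hσ : IsCentral σ) (he : e ∈ center σ)
    (hB : IsRelChain ρ B) (heB : e ∈ B) {γ : I ⊕ I' → A} (hγ : ∀ i, γ (Sum.inl i) ∈ B) :
    γ ∈ linkRel ρ σ I I' :=
  ⟨e, hB.mem_centerOver heB (Set.range_subset_iff.2 hγ), hσ.center_subset_centerOver he⟩

theorem TotallyReflexive.isRelChain_range_ne (hρ : TotallyReflexive ρ) {m : Fin h}
    (v : {i // i ≠ m} → A) : IsRelChain ρ (Set.range v) := by
  refine hρ.isRelChain_of_encard_lt ?_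
  have hlt := (Set.toFinite ({m}ᶜ : Set (Fin h))).encard_lt_encard
    (Set.ssubset_univ_iff.2 (Set.compl_ne_univ.2 (Set.singleton_nonempty m)))
  calc (Set.range v).encard ≤ (Set.univ : Set {i // i ≠ m}).encard := by
        rw [← Set.image_univ]; exact Set.encard_image_le _ _
    _ = ({m}ᶜ : Set (Fin h)).encard := Set.encard_univ _
    _ < h := by simpa using hlt

theorem IsCentral.exists_mem_linkRel_comp_notMem (hρ : IsCentral ρ) (hσ : IsCentral σ)
    (hh : 2 ≤ h) (hs : 2 ≤ s) (he : e ∈ center σ) (heρ : e ∉ center ρ) {q : Fin h → I ⊕ I'}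
    (hq : Injective q) : ∃ t ∈ linkRel ρ σ I I', (fun m => t (q m)) ∉ ρ := by
  obtain ⟨c, hc⟩ := hρ.center_nonempty
  by_cases hleft : ∀ m, ∃ i, q m = Sum.inl i
  · obtain ⟨v, hv⟩ := hρ.exists_notMem
    refine ⟨extend q v fun _ => c, hρ.mem_linkRel_of_chain_right hc
      (hσ.totallyReflexive.isRelChain_singleton hs c) rfl fun i => extend_apply' _ _ _ ?_,
      by simpa only [hq.extend_apply]⟩
    rintro ⟨m, hm⟩
    obtain ⟨j, hj⟩ := hleft m
    simp [hj] at hm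
  · push Not at hleft
    obtain ⟨m₀, hm₀⟩ := hleft
    have : Nontrivial (Fin h) := Fin.nontrivial_iff_two_le.2 hh
    obtain ⟨m₁, hm₁⟩ := _root_.exists_ne m₀
    obtain ⟨v, hv, rfl⟩ := hρ.exists_notMem_apply_eq heρ m₁
    refine ⟨extend q v fun _ => c, hσ.mem_linkRel_of_chain_left he (hρ.isRelChain_union_center
      (hρ.totallyReflexive.isRelChain_range_ne fun i : {i // i ≠ m₀} => v i))
      (Or.inl ⟨⟨m₁, hm₁⟩, rfl⟩)
      fun i => ?_, by simpa only [hq.extend_apply]⟩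
    by_cases hi : ∃ m, q m = Sum.inl i
    · obtain ⟨m, hm⟩ := hi
      rw [← hm, hq.extend_apply]
      exact Or.inl ⟨⟨m, fun hmm => hm₀ i (hmm ▸ hm)⟩, rfl⟩
    · rw [extend_apply' _ _ _ hi]
      exact Or.inr hc

theorem IsCentral.mem_linkRel_of_invariant [Finite A] [Finite I] [Finite I'] (hρ : IsCentral ρ)
    (hσ : IsCentral σ) (hh : 2 ≤ h) (hs : 2 ≤ s) (hdisj : ¬ (center ρ ∩ center σ).Nonempty)
    (hinv : (Pol {⟨h, ρ⟩}).Invariant (linkRel ρ σ I I')) (γ : I ⊕ I' → A) :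
    γ ∈ linkRel ρ σ I I' := by
  classical
  obtain ⟨c, hc⟩ := hρ.center_nonempty
  obtain ⟨e, he⟩ := hσ.center_nonempty
  obtain ⟨a, ha⟩ := hρ.exists_ne c
  have hright : ∀ γ : I ⊕ I' → A, (∀ i, γ (Sum.inr i) = c) → γ ∈ linkRel ρ σ I I' := fun γ hγ =>
    hρ.mem_linkRel_of_chain_right hc (hσ.totallyReflexive.isRelChain_singleton hs c) rfl hγ
  have hleft : ∀ γ : I ⊕ I' → A, (∀ i, γ (Sum.inl i) = c) → γ ∈ linkRel ρ σ I I' := fun γ hγ =>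
    hσ.mem_linkRel_of_chain_left he (hρ.isRelChain_union_center
      (hρ.totallyReflexive.isRelChain_singleton hh e)) (Or.inl rfl) fun i => Or.inr (hγ i ▸ hc)
  refine hρ.relClosure_subset hinv
    ⟨fun _ => c, hright _ fun _ => rfl⟩ (CloneTheory.rows_injective ha.symm ?_)
    (hρ.totallyReflexive.mem_relClosure fun q hq => Or.inr
      (hρ.exists_mem_linkRel_comp_notMem hσ hh hs he (fun heρ => hdisj ⟨e, heρ, he⟩) hq))
  rintro (i | i)
  · exact hright _ fun _ => by simp
  · exact hleft _ fun _ => by simp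

end Link

section CenterEntry

variable {A ι : Type*} {h s : ℕ} {ρ : Set (Fin h → A)} {σ : Set (Fin s → A)} {w : Fin s → A}
  {z : Fin s}

theorem IsCentral.preservesRel_rowOp_of_mem_center (hρ : IsCentral ρ) (hσ : IsCentral σ)
    (hz : w z ∈ center ρ) : PreservesRel (rowOp σ w (w z)) ρ := by
  refine hρ.preservesRel_rowOp hz hσ.rows_injective
    (hρ.totallyReflexive.mem_relClosure fun q hq => ?_)
  by_cases hqz : ∃ i, q i = z
  · obtain ⟨i, rfl⟩ := hqz
    exact Or.inl (hρ.mem_of_mem_center i hz)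
  · obtain ⟨v, hv⟩ := hρ.exists_notMem
    obtain ⟨t, ht, rfl⟩ := hσ.exists_mem_comp_eq hq (fun i hi => hqz ⟨i, hi⟩) v
    exact Or.inr ⟨t, ht, hv⟩

theorem IsCentral.exists_rowOp_eq (hσ : IsCentral σ) (w : Fin s → A) (z : Fin s) (x : σ → A) :
    ∃ i, rowOp σ w (w z) x = w i ∧ (i ≠ z → rows σ i = x) := by
  by_cases hx : ∃ i, rows σ i = x
  · obtain ⟨i, hi⟩ := hx
    exact ⟨i, hi ▸ hσ.rows_injective.extend_apply w _ i, fun _ => hi⟩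
  · exact ⟨z, extend_apply' _ _ _ hx, fun hz => absurd rfl hz⟩

theorem IsCentral.centerOver_range_inter_nonempty_of_le (hρ : IsCentral ρ) (hσ : IsCentral σ)
    (hsh : s ≤ h) {z' : Fin s} (hzz' : z ≠ z') (hz : w z ∈ center ρ) (hz' : w z' ∈ center ρ) :
    (centerOver ρ (Set.range w) ∩ centerOver σ (Set.range w)).Nonempty := by
  obtain ⟨e, he⟩ := hσ.center_nonempty
  let S : Set (Fin s) := {z, z'}ᶜ
  have hS : (insert z S).encard < h := by
    have hne : insert z S ≠ Set.univ := (Set.ne_univ_iff_exists_notMem _).2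
      ⟨z', by simp [S, hzz'.symm]⟩
    have hlt := (Set.toFinite (insert z S)).encard_lt_encard (Set.ssubset_univ_iff.2 hne)
    exact (by simpa using hlt : (insert z S).encard < s).trans_le (by exact_mod_cast hsh)
  have hcard : (insert e (w '' S)).encard < h := calc
    (insert e (w '' S)).encard ≤ (w '' S).encard + 1 := Set.encard_insert_le _ _
    _ ≤ S.encard + 1 := by gcongr; exact Set.encard_image_le _ _
    _ = (insert z S).encard := (Set.encard_insert_of_notMem (by simp [S])).symm
    _ < h := hS
  refine ⟨e, (hρ.isRelChain_union_center
    (hρ.totallyReflexive.isRelChain_of_encard_lt hcard)).mem_centerOver (Or.inl (Or.inl rfl)) ?_,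
    hσ.center_subset_centerOver he⟩
  rintro _ ⟨i, rfl⟩
  by_cases hi : i ∈ S
  · exact Or.inl (Or.inr ⟨i, hi, rfl⟩)
  · obtain rfl | rfl : i = z ∨ i = z' := by simpa [S, or_iff_not_imp_left] using hi
    exacts [Or.inr hz, Or.inr hz']

/-- The tuples of `σ` whose entries at the positions in `S` belong to the center of `ρ` relative to
all their entries. -/
def centralAt (ρ : Set (Fin h → A)) (σ : Set (Fin s → A)) (S : Set (Fin s)) : Set (Fin s → A) :=
  {t ∈ σ | ∀ i ∈ S, t i ∈ centerOver ρ (Set.range t)}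

theorem PreservesRel.mem_centralAt {N : Type*} {f : (N → A) → A} (hf : PreservesRel f ρ)
    {S : Set (Fin s)} {a : N → Fin s → A} (ha : ∀ j, a j ∈ centralAt ρ σ S)
    (hfa : (fun i => f fun j => a j i) ∈ σ) : (fun i => f fun j => a j i) ∈ centralAt ρ σ S :=
  ⟨hfa, fun i hi => hf.mem_centerOver fun j => (ha j).2 i hi⟩

theorem invariant_centralAt (ρ : Set (Fin h → A)) (σ : Set (Fin s → A)) (S : Set (Fin s)) :
    (Pol {⟨h, ρ⟩, ⟨s, σ⟩}).Invariant (centralAt ρ σ S) := by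
  intro n f hf a ha
  obtain ⟨-, hfρ, hfσ⟩ := mem_ops_pol_pair.1 hf
  exact hfρ.mem_centralAt ha (hfσ a fun j => (ha j).1)

theorem exists_injective_avoiding (hsh : h < s) (m : Fin h) {y p : Fin s} (hyp : y ≠ p) :
    ∃ q : Fin h → Fin s, Injective q ∧ q m = y ∧ ∀ i, q i ≠ p := by
  obtain ⟨n, rfl⟩ : ∃ n, s = n + 1 := ⟨s - 1, by omega⟩
  obtain ⟨y', rfl⟩ := Fin.exists_succAbove_eq hyp
  have hhn : h ≤ n := Nat.lt_succ_iff.1 hsh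
  refine ⟨fun i => p.succAbove (Equiv.swap (Fin.castLE hhn m) y' (Fin.castLE hhn i)),
    Fin.succAbove_right_injective.comp
      ((Equiv.injective _).comp (Fin.castLE_injective hhn)), by simp, fun i => p.succAbove_ne _⟩

theorem IsCentral.preservesRel_rowOp_centralAt (hρ : IsCentral ρ) (hσ : IsCentral σ) (hsh : h < s)
    {S : Set (Fin s)} (hS : S.Nontrivial) (hz : w z ∈ center ρ) :
    PreservesRel (rowOp σ w (w z)) (centralAt ρ σ S) := by
  intro a ha
  refine (hρ.preservesRel_rowOp_of_mem_center hσ hz).mem_centralAt ha ?_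
  by_contra hbad
  choose r hr hrz using fun p => hσ.exists_rowOp_eq w z fun t => a t p
  simp only [hr] at hbad
  have hrinj : Injective r := fun i j hij =>
    hσ.totallyReflexive.injective_of_notMem hbad (congrArg w hij)
  obtain ⟨p, rfl⟩ := Finite.injective_iff_surjective.1 hrinj z
  obtain ⟨y, hyS, hyp⟩ := hS.exists_ne p
  let m : Fin h := ⟨0, hρ.arity_pos⟩
  obtain ⟨q, hq, hqm, hqp⟩ := exists_injective_avoiding hsh m hyp
  obtain ⟨v, hv⟩ := hρ.exists_notMem
  obtain ⟨t, ht, rfl⟩ := hσ.exists_mem_comp_eq (hrinj.comp hq)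
    (fun i hi => hqp i (hrinj hi)) v
  have hat : ∀ i, a ⟨t, ht⟩ (q i) = t (r (q i)) := fun i =>
    (congrFun (hrz (q i) fun hi => hqp i (hrinj hi)) ⟨t, ht⟩).symm
  refine hv ((ha ⟨t, ht⟩).2 y hyS _ m ?_ fun i _ => ⟨q i, hat i⟩)
  rw [← hqm, hat m, comp_apply]

theorem IsCentral.mem_relClosure_centralAt_pair (hρ : IsCentral ρ) (hσ : IsCentral σ)
    {z' : Fin s} (hzz' : z ≠ z') (hz : w z ∈ center ρ) (hz' : w z' ∈ center ρ) :
    w ∈ relClosure ρ (centralAt ρ σ {z, z'}) := by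
  refine hρ.totallyReflexive.mem_relClosure fun q hq => ?_
  by_cases hhit : ∃ m, q m = z ∨ q m = z'
  · obtain ⟨m, hm⟩ := hhit
    have hcen : w (q m) ∈ center ρ := by rcases hm with hm | hm <;> rwa [hm]
    exact Or.inl (hρ.mem_of_mem_center m hcen)
  · obtain ⟨v, hv⟩ := hρ.exists_notMem
    have hext : ∀ i, i = z ∨ i = z' → extend q v (fun _ => w z) i = w z := fun i hi =>
      extend_apply' _ _ _ fun ⟨m, hm⟩ => hhit ⟨m, hm ▸ hi⟩
    refine Or.inr ⟨extend q v fun _ => w z, ⟨hσ.totallyReflexive _ ⟨z, z', hzz', ?_⟩,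
      fun i hi => hρ.center_subset_centerOver ((hext i hi).symm ▸ hz)⟩,
      by simpa only [hq.extend_apply]⟩
    rw [hext z (Or.inl rfl), hext z' (Or.inr rfl)]

theorem IsCentral.preservesRel_rowOp_linkRel (hρ : IsCentral ρ) (hσ : IsCentral σ)
    {I : Type*} (hz : w z ∈ center ρ) :
    PreservesRel (rowOp σ w (w z)) (linkRel ρ σ I {i // i ≠ z}) := by
  classical
  intro γ hγ
  choose r hr hrz using fun p => hσ.exists_rowOp_eq w z fun t => γ t p
  obtain ⟨e, he⟩ := hσ.center_nonempty
  let t : σ := ⟨update w z e, hσ.mem_of_mem_center z (by simpa using he)⟩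
  have ht : ∀ p, r p ≠ z → γ t p = w (r p) := fun p hp => by
    simpa [rows, t, hp] using (congrFun (hrz p hp) t).symm
  simp only [linkRel, Set.mem_ofPred_eq, hr]
  by_cases hhit : ∃ i, r (Sum.inr i) = z
  · obtain ⟨i, hi⟩ := hhit
    exact ⟨w z, hρ.center_subset_centerOver hz,
      (hσ.totallyReflexive.isRelChain_range_ne fun i => w (r (Sum.inr i))).mem_centerOver
        ⟨i, congrArg w hi⟩ subset_rfl⟩
  · push Not at hhit
    obtain ⟨u, huρ, huσ⟩ := hγ t
    simp only [ht _ (hhit _)] at huσ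
    refine ⟨u, centerOver_anti (Set.range_subset_iff.2 fun i => ?_)
      (hρ.centerOver_subset_centerOver_union_center huρ), huσ⟩
    by_cases hi : r (Sum.inl i) = z
    · exact Or.inr (by rwa [hi])
    · exact Or.inl ⟨i, ht _ hi⟩

variable [Finite A]

theorem IsCentral.relClosure_centralAt_subset (hρ : IsCentral ρ) (hσ : IsCentral σ)
    (hh : 2 ≤ h) (hsh : h < s) {S : Set (Fin s)}
    (hinv : (Pol {⟨h, ρ⟩}).Invariant (centralAt ρ σ S)) :
    relClosure ρ (centralAt ρ σ S) ⊆ centralAt ρ σ S := by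
  classical
  obtain ⟨c, hc⟩ := hρ.center_nonempty
  obtain ⟨b, hb⟩ := hρ.exists_ne c
  have hupd : ∀ i j, update (fun _ : Fin s => c) i b j ∈ ({b, c} : Set A) := fun i j => by
    rcases eq_or_ne j i with rfl | hj <;> simp [*]
  have hsub : ({b, c} : Set A) ⊆ {b} ∪ center ρ := Set.insert_subset_insert (by simpa using hc)
  have hcard : ({b, c} : Set A).encard < s := calc
    ({b, c} : Set A).encard ≤ ({c} : Set A).encard + 1 := Set.encard_insert_le _ _
    _ = 2 := by rw [Set.encard_singleton, one_add_one_eq_two]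
    _ < s := by exact_mod_cast hh.trans_lt hsh
  have hmem : ∀ i, update (fun _ => c) i b ∈ centralAt ρ σ S := fun i =>
    ⟨hσ.totallyReflexive.isRelChain_of_encard_lt hcard _ (hupd i), fun j _ =>
      (hρ.isRelChain_union_center (hρ.totallyReflexive.isRelChain_singleton hh b)).mem_centerOver
        (hsub (hupd i j)) (Set.range_subset_iff.2 fun l => hsub (hupd i l))⟩
  exact hρ.relClosure_subset hinv ⟨_, hmem ⟨0, by omega⟩⟩ (CloneTheory.rows_injective hb.symm hmem)

theorem IsSubmaximal.invariant_of_rowOp (hcov : IsSubmaximal ρ σ) (hσ : IsCentral σ)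
    (hw : w ∉ σ) {c : A} (hwρ : PreservesRel (rowOp σ w c) ρ) {R : Set (ι → A)}
    (hR : (Pol {⟨h, ρ⟩, ⟨s, σ⟩}).Invariant R) (hwR : PreservesRel (rowOp σ w c) R) :
    (Pol {⟨h, ρ⟩}).Invariant R :=
  have : Nonempty σ := hσ.nonempty.to_subtype
  hcov.invariant hR hwρ (fun hf => hw (mem_of_preservesRel_rowOp hσ.rows_injective hf)) hwR

/- All values of `rowOp σ w (w z)` are entries of `w`, so a common element of the two relative
centers would make this operation preserve `linkRel`. -/
theorem IsSubmaximal.not_nonempty_centerOver_range_inter (hcov : IsSubmaximal ρ σ)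
    (hρ : IsCentral ρ) (hσ : IsCentral σ) (hh : 2 ≤ h) (hs : 2 ≤ s)
    (hdisj : ¬ (center ρ ∩ center σ).Nonempty)
    (hw : w ∉ σ) (hz : w z ∈ center ρ) :
    ¬ (centerOver ρ (Set.range w) ∩ centerOver σ (Set.range w)).Nonempty := by
  rintro ⟨d, hdρ, hdσ⟩
  have hrange : ∀ x, rowOp σ w (w z) x ∈ Set.range w := fun x => by
    obtain ⟨i, hi, -⟩ := hσ.exists_rowOp_eq w z x
    exact ⟨i, hi.symm⟩
  have hinv := hcov.invariant_of_rowOp hσ hw (hρ.preservesRel_rowOp_of_mem_center hσ hz)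
    (invariant_linkRel ρ σ A A) fun _ _ =>
      ⟨d, centerOver_anti (Set.range_subset_iff.2 fun _ => hrange _) hdρ,
        centerOver_anti (Set.range_subset_iff.2 fun _ => hrange _) hdσ⟩
  obtain ⟨u, huρ, huσ⟩ := hρ.mem_linkRel_of_invariant hσ hh hs hdisj hinv (Sum.elim id id)
  simp only [Sum.elim_inl, Sum.elim_inr, id, Set.range_id'] at huρ huσ
  exact hdisj ⟨u, centerOver_univ_subset_center huρ, centerOver_univ_subset_center huσ⟩

theorem IsSubmaximal.mem_of_mem_center_of_ne (hcov : IsSubmaximal ρ σ) (hρ : IsCentral ρ)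
    (hσ : IsCentral σ) (hh : 2 ≤ h) (hs : 2 ≤ s) (hdisj : ¬ (center ρ ∩ center σ).Nonempty)
    {z' : Fin s} (hzz' : z ≠ z') (hz : w z ∈ center ρ) (hz' : w z' ∈ center ρ) : w ∈ σ := by
  by_contra hw
  rcases le_or_gt s h with hsh | hsh
  · exact hcov.not_nonempty_centerOver_range_inter hρ hσ hh hs hdisj hw hz
      (hρ.centerOver_range_inter_nonempty_of_le hσ hsh hzz' hz hz')
  · have hinv := hcov.invariant_of_rowOp hσ hw (hρ.preservesRel_rowOp_of_mem_center hσ hz)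
      (invariant_centralAt ρ σ {z, z'})
      (hρ.preservesRel_rowOp_centralAt hσ hsh (Set.nontrivial_pair hzz') hz)
    exact hw (hρ.relClosure_centralAt_subset hσ hh hsh hinv
      (hρ.mem_relClosure_centralAt_pair hσ hzz' hz hz')).1

theorem IsSubmaximal.center_inter_center_nonempty (hcov : IsSubmaximal ρ σ) (hρ : IsCentral ρ)
    (hσ : IsCentral σ) (hh : 2 ≤ h) (hs : 2 ≤ s) : (center ρ ∩ center σ).Nonempty := by
  by_contra hdisj
  obtain ⟨c, hc⟩ := hρ.center_nonempty
  let z : Fin s := ⟨0, hσ.arity_pos⟩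
  obtain ⟨w, hw, rfl⟩ := hσ.exists_notMem_apply_eq (fun hcσ => hdisj ⟨c, hc, hcσ⟩) z
  have hinv := hcov.invariant_of_rowOp hσ hw (hρ.preservesRel_rowOp_of_mem_center hσ hc)
    (invariant_linkRel ρ σ A {i // i ≠ z}) (hρ.preservesRel_rowOp_linkRel hσ hc)
  obtain ⟨u, huρ, huσ⟩ :=
    hρ.mem_linkRel_of_invariant hσ hh hs hdisj hinv (Sum.elim id fun i => w i)
  simp only [Sum.elim_inl, Sum.elim_inr, id, Set.range_id'] at huρ huσ
  have huc : u ∈ center ρ := centerOver_univ_subset_center huρ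
  refine hcov.not_nonempty_centerOver_range_inter hρ hσ hh hs hdisj hw hc
    ⟨u, hρ.center_subset_centerOver huc, fun x i hi hx => ?_⟩
  by_cases hhit : ∃ j ≠ i, x j = w z
  · obtain ⟨j, hj, hjz⟩ := hhit
    exact hcov.mem_of_mem_center_of_ne hρ hσ hh hs hdisj hj (hjz ▸ hc) (hi ▸ huc)
  · push Not at hhit
    refine huσ x i hi fun j hj => ?_
    obtain ⟨l, hl⟩ := hx j hj
    exact ⟨⟨l, fun hlz => hhit j hj (by rw [← hl, hlz])⟩, hl⟩

end CenterEntry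

section Comparability

variable {A : Type*} {h s : ℕ} {ρ : Set (Fin h → A)} {σ : Set (Fin s → A)} {w : Fin s → A} {c : A}

theorem invariant_inter_extendArity (e : h ≤ s) (ρ : Set (Fin h → A)) (σ : Set (Fin s → A)) :
    (Pol {⟨h, ρ⟩, ⟨s, σ⟩}).Invariant (σ ∩ extendArity e ρ) := by
  intro n f hf a ha
  obtain ⟨-, hfρ, hfσ⟩ := mem_ops_pol_pair.1 hf
  exact ⟨hfσ a fun j => (ha j).1, hfρ (fun j i => a j (Fin.castLE e i)) fun j => (ha j).2⟩

theorem IsCentral.preservesRel_rowOp_of_not_subset (hρ : IsCentral ρ) (hσ : IsCentral σ)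
    (hcρ : c ∈ center ρ) {e : h ≤ s} (hsub : ¬ σ ⊆ extendArity e ρ) :
    PreservesRel (rowOp σ w c) ρ :=
  hρ.preservesRel_rowOp hcρ hσ.rows_injective
    (hρ.totallyReflexive.mem_relClosure fun _ hq => Or.inr (hσ.exists_mem_comp_notMem hsub hq))

theorem IsCentral.preservesRel_rowOp_inter_extendArity (hρ : IsCentral ρ) (hσ : IsCentral σ)
    (hcρ : c ∈ center ρ) (hcσ : c ∈ center σ) {e : h ≤ s} (hsub : ¬ σ ⊆ extendArity e ρ) :
    PreservesRel (rowOp σ w c) (σ ∩ extendArity e ρ) := by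
  intro a ha
  refine ⟨?_, hρ.preservesRel_rowOp_of_not_subset hσ hcρ hsub
    (fun j i => a j (Fin.castLE e i)) fun j => (ha j).2⟩
  by_cases hrows : ∀ i, ∃ l, rows σ l = fun t => a t i
  · choose r hr using hrows
    have hval : (fun i => rowOp σ w c fun t => a t i) = fun i => w (r i) := funext fun i => by
      rw [← hr i, rowOp, hσ.rows_injective.extend_apply]
    rw [hval]
    refine hσ.totallyReflexive.comp_mem_of_not_injective w fun hrinj => ?_
    obtain ⟨t, ht, htρ⟩ :=
      hσ.exists_mem_comp_notMem hsub (hrinj.comp (Fin.castLE_injective e))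
    have hat : (fun i => a ⟨t, ht⟩ (Fin.castLE e i)) = fun i => t (r (Fin.castLE e i)) :=
      funext fun i => (congrFun (hr (Fin.castLE e i)) ⟨t, ht⟩).symm
    exact htρ (hat ▸ (ha ⟨t, ht⟩).2)
  · obtain ⟨i, hi⟩ := not_forall.1 hrows
    refine hσ.mem_of_mem_center i ?_
    rwa [rowOp, extend_apply' _ _ _ hi]

theorem IsCentral.mem_inter_extendArity (hρ : IsCentral ρ) (hσ : IsCentral σ)
    (hcρ : c ∈ center ρ) (hcσ : c ∈ center σ) (e : h ≤ s) {t : Fin s → A} {m : Fin h}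
    (ht : t (Fin.castLE e m) = c) : t ∈ σ ∩ extendArity e ρ :=
  ⟨hσ.mem_of_mem_center _ (ht ▸ hcσ), hρ.mem_of_mem_center m (ht ▸ hcρ)⟩

theorem IsCentral.extendArity_subset_relClosure (hρ : IsCentral ρ) (hσ : IsCentral σ)
    (hcρ : c ∈ center ρ) (hcσ : c ∈ center σ) (e : h ≤ s) :
    extendArity e ρ ⊆ relClosure ρ (σ ∩ extendArity e ρ) := by
  refine fun y hy => hρ.totallyReflexive.mem_relClosure fun q hq => ?_
  by_cases hrange : ∀ m, ∃ l, q l = Fin.castLE e m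
  · choose r hr using hrange
    have hrinj : Injective r := fun i j hij =>
      Fin.castLE_injective e ((hr i).symm.trans ((congrArg q hij).trans (hr j)))
    let π := Equiv.ofBijective r (Finite.injective_iff_bijective.1 hrinj)
    have hq' : ∀ m, q m = Fin.castLE e (π.symm m) := fun m => by
      rw [← hr]
      exact congrArg q (π.apply_symm_apply m).symm
    simp only [hq']
    exact Or.inl (hρ.comp_mem hy π.symm)
  · push Not at hrange
    obtain ⟨m, hm⟩ := hrange
    obtain ⟨v, hv⟩ := hρ.exists_notMem
    exact Or.inr ⟨extend q v fun _ => c,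
      hρ.mem_inter_extendArity hσ hcρ hcσ e (extend_apply' _ _ _ fun ⟨l, hl⟩ => hm l hl),
      by simpa only [hq.extend_apply]⟩

theorem IsCentral.rows_inter_extendArity_injective (hρ : IsCentral ρ) (hσ : IsCentral σ)
    (hcρ : c ∈ center ρ) (hcσ : c ∈ center σ) (hh : 2 ≤ h) (e : h ≤ s) :
    Injective (rows (σ ∩ extendArity e ρ)) := by
  obtain ⟨b, hb⟩ := hρ.exists_ne c
  refine CloneTheory.rows_injective hb.symm fun i => ?_
  have : Nontrivial (Fin h) := Fin.nontrivial_iff_two_le.2 hh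
  obtain ⟨m, hm⟩ : ∃ m, Fin.castLE e m ≠ i := by
    obtain ⟨m, m', hmm'⟩ := exists_pair_ne (Fin h)
    by_contra! hall
    exact hmm' (Fin.castLE_injective e ((hall m).trans (hall m').symm))
  exact hρ.mem_inter_extendArity hσ hcρ hcσ e (m := m) (update_of_ne hm _ _)

theorem IsSubmaximal.extendArity_subset_or_subset [Finite A] (hcov : IsSubmaximal ρ σ)
    (hρ : IsCentral ρ) (hσ : IsCentral σ) (hh : 2 ≤ h) (e : h ≤ s) :
    extendArity e ρ ⊆ σ ∨ σ ⊆ extendArity e ρ := by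
  obtain ⟨c, hcρ, hcσ⟩ := hcov.center_inter_center_nonempty hρ hσ hh (hh.trans e)
  refine or_iff_not_imp_right.2 fun hsub => ?_
  obtain ⟨w, hw⟩ := hσ.exists_notMem
  have hinv := hcov.invariant_of_rowOp hσ hw (hρ.preservesRel_rowOp_of_not_subset hσ hcρ hsub)
    (invariant_inter_extendArity e ρ σ)
    (hρ.preservesRel_rowOp_inter_extendArity hσ hcρ hcσ hsub)
  have hne : (σ ∩ extendArity e ρ).Nonempty :=
    ⟨fun _ => c, hρ.mem_inter_extendArity hσ hcρ hcσ e (m := ⟨0, hρ.arity_pos⟩) rfl⟩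
  exact (hρ.extendArity_subset_relClosure hσ hcρ hcσ e).trans ((hρ.relClosure_subset hinv hne
    (hρ.rows_inter_extendArity_injective hσ hcρ hcσ hh e)).trans Set.inter_subset_left)

end Comparability

section Classification

variable {A : Type*} [Finite A] {h s : ℕ} {ρ : Set (Fin h → A)} {σ : Set (Fin s → A)}

theorem IsSubmaximal.typeI_or_typeII {σ : Set (Fin 1 → A)} (hcov : IsSubmaximal ρ σ)
    (hρ : IsCentral ρ) (hσ : IsCentral σ) (hh : 2 ≤ h) : TypeI ρ σ ∨ TypeII ρ σ := by
  by_cases hmeet : (center ρ ∩ unarySet σ).Nonempty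
  · exact Or.inl ⟨rfl, hmeet⟩
  obtain rfl | hh₃ := hh.eq_or_lt
  · exact Or.inr ⟨rfl, rfl, hcov.eq_commonNeighbour hρ hσ hmeet,
      fun _ => hcov.maximal_chain_inter_nonempty hρ hσ hmeet⟩
  · obtain ⟨n, rfl⟩ : ∃ n, h = n + 1 := ⟨h - 1, by omega⟩
    exact absurd (hcov.center_inter_unarySet_nonempty hρ hσ (Nat.lt_succ_iff.1 hh₃)) hmeet

theorem IsSubmaximal.typeIII {σ : Set (Fin h → A)} (hcov : IsSubmaximal ρ σ) (hρ : IsCentral ρ)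
    (hσ : IsCentral σ) (hh : 2 ≤ h) (hne : ρ ≠ σ) : TypeIII ρ σ :=
  ⟨rfl, (hcov.extendArity_subset_or_subset hρ hσ hh le_rfl).imp
    (fun hsub => LE.le.ssubset_of_ne hsub hne)
    fun hsub => LE.le.ssubset_of_ne hsub hne.symm⟩

theorem IsSubmaximal.typeV (hcov : IsSubmaximal ρ σ) (hρ : IsCentral ρ) (hσ : IsCentral σ)
    (hh : 2 ≤ h) (hhs : h < s) : TypeV ρ σ :=
  have hnot := hρ.not_subset_extendArity hσ hhs
  ⟨hh, hhs, (hcov.extendArity_subset_or_subset hρ hσ hh hhs.le).resolve_right hnot, hnot⟩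

theorem TypeI.isSubmaximal (hρ : IsCentral ρ) (hσ : IsCentral σ) (hh : 2 ≤ h) (hI : TypeI ρ σ) :
    IsSubmaximal ρ σ := by
  obtain ⟨rfl, hmeet⟩ := hI
  exact isSubmaximal_of_lt hρ hσ hh (center_eq_unarySet (σ := σ) ▸ hmeet)

theorem TypeII.isSubmaximal (hρ : IsCentral ρ) (hσ : IsCentral σ) (hII : TypeII ρ σ) :
    IsSubmaximal ρ σ := by
  obtain ⟨rfl, rfl, hcn, hmax⟩ := hII
  exact isSubmaximal_of_chains hρ hσ hcn.ge hmax

theorem TypeIII.isSubmaximal (hρ : IsCentral ρ) (hσ : IsCentral σ) (hIII : TypeIII ρ σ) :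
    IsSubmaximal ρ σ := by
  obtain ⟨rfl, hsub | hsub⟩ := hIII
  · exact isSubmaximal_of_extendArity_ssubset hρ hσ le_rfl hsub
  · exact isSubmaximal_of_ssubset hρ hσ hsub

end Classification

end CloneTheory

open CloneTheory in
theorem theorem1_general {A : Type*} [Finite A] {h s : ℕ} (hh : 2 ≤ h) {ρ : Set (Fin h → A)}
    {σ : Set (Fin s → A)} (hρ : IsCentral ρ) (hσ : IsCentral σ)
    (hne : (⟨s, σ⟩ : FinRel A) ≠ ⟨h, ρ⟩) :
    Pol {⟨h, ρ⟩, ⟨s, σ⟩} ⋖ Pol {⟨h, ρ⟩} ↔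
      TypeI ρ σ ∨ TypeII ρ σ ∨ TypeIII ρ σ ∨ TypeIV ρ σ ∨ TypeV ρ σ := by
  constructor
  · intro (hcov : IsSubmaximal ρ σ)
    obtain rfl | hs : 1 = s ∨ 2 ≤ s := hσ.arity_pos.eq_or_lt
    · exact (hcov.typeI_or_typeII hρ hσ hh).imp_right Or.inl
    refine Or.inr (Or.inr ?_)
    obtain hsh | rfl | hhs := lt_trichotomy s h
    · exact Or.inr (Or.inl ⟨hs, hsh, hcov.center_inter_center_nonempty hρ hσ hh hs⟩)
    · exact Or.inl (hcov.typeIII hρ hσ hh fun heq => hne (heq ▸ rfl))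
    · exact Or.inr (Or.inr (hcov.typeV hρ hσ hh hhs))
  · rintro (hI | hII | hIII | ⟨-, hsh, hmeet⟩ | ⟨-, hhs, hsub⟩)
    · exact hI.isSubmaximal hρ hσ hh
    · exact hII.isSubmaximal hρ hσ
    · exact hIII.isSubmaximal hρ hσ
    · exact isSubmaximal_of_lt hρ hσ hsh hmeet
    · exact isSubmaximal_of_extendArity_ssubset hρ hσ hhs.le hsub

theorem theorem1 (k : ℕ) (hk : 3 ≤ k) (h : ℕ) (hh : 2 ≤ h) (s : ℕ) (hs : 1 ≤ s)
    (ρ : Set (Fin h → Fin k)) (σ : Set (Fin s → Fin k))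
    (hρ : CloneTheory.IsCentral ρ) (hσ : CloneTheory.IsCentral σ)
    (hne : (⟨s, σ⟩ : CloneTheory.FinRel (Fin k)) ≠ ⟨h, ρ⟩) :
    CloneTheory.Pol ({⟨h, ρ⟩, ⟨s, σ⟩} : Set (CloneTheory.FinRel (Fin k))) ⋖
        CloneTheory.Pol ({⟨h, ρ⟩} : Set (CloneTheory.FinRel (Fin k))) ↔
      CloneTheory.TypeI ρ σ ∨ CloneTheory.TypeII ρ σ ∨ CloneTheory.TypeIII ρ σ ∨
        CloneTheory.TypeIV ρ σ ∨ CloneTheory.TypeV ρ σ := by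
  exact theorem1_general hh hρ hσ hne
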